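/- Let $T\in\mathbb N$, $p\in(1,\infty)$, $q=p/(p-1)$, $L\ge 0$. Let $X$ be the canonical process (identity map) on $\mathbb R^T$, $\mathcal F_t^X=\sigma(X_1,\dots,X_t)$ (with $\mathcal F_0^X$ trivial), and let $\mathcal P_p(\mathbb R^T)$ be the set of Borel probability measures on $\mathbb R^T$ with finite $p$-th moment. For $P,Q\in\mathcal P_p(\mathbb R^T)$, a coupling $\pi$ of $P$ and $Q$ (a Borel probability measure on $\mathbb R^T\times\mathbb R^T$ with marginals $P,Q$ and coordinate projections $X,Y$) is causal if $\pi((Y_1,\dots,Y_t)\in A\mid X_1,\dots,X_T)=\pi((Y_1,\dots,Y_t)\in A\mid X_1,\dots,X_t)$ $\pi$-a.s. for all $1\le t\le T$ and all Borel $A\subseteq\mathbb R^t$, and bicausal if this also holds with the roles of $X$ and $Y$ reversed. Put $$\mathcal{AW}_p(P,Q)=\inf_{\pi\text{ bicausal}}\Big(\sum_{t=1}^T E_\pi[|X_t-Y_t|^p]\Big)^{1/p},\qquad B_r(P)=\{Q\in\mathcal P_p(\mathbb R^T):\mathcal{AW}_p(P,Q)\le r\}.$$ Let $\mathcal A$ be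 the set of predictable controls bounded by $L$, i.e. of all $a=(a_t)_{t=1}^T:\mathbb R^T\to[-L,L]^T$ such that $a_t$ is $\mathcal F_{t-1}^X$-measurable for every $t$, and let $v(Q)=\inf_{a\in\mathcal A}E_Q[f(X,a(X))]$. Let $P\in\mathcal P_p(\mathbb R^T)$ and let $f:\mathbb R^T\times\mathbb R^T\to\mathbb R$ satisfy: (i) for every $x$, $f(x,\cdot)$ is twice continuously differentiable on $\mathbb R^T$ and convex on $[-L,L]^T$; (ii) there is a function $\varepsilon$ with $\varepsilon(X)>0$ $P$-a.s. such that, $P$-a.s., $\nabla_a^2 f(X,a)-\varepsilon(X)I$ is positive semidefinite for every $a\in[-L,L]^T$; (iii) $f(\cdot,a)$ is differentiable for every $a\in\mathbb R^T$, the partial derivatives $\partial_{x_t}f$ are jointly continuous in $(x,a)$, and there is $c>0$ with $\sum_{s=1}^T|\partial_{x_s}f(x,a)|\le c\,(1+\sum_{s=1}^T|x_s|^{p-1})$ for all $x\in\mathbb R^T$ and $a\in[-L,L]^T$. Then all the expectations, infima and suprema below are well defined and finite, and there exists a control $a^\ast\in\mathcal A$, unique up to $P$-almost sure equality, such that $v(P)=E_P[f(X,a^\ast(X))]$.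 Moreover, as $r\downarrow 0$, $$\sup_{Q\in B_r(P)}v(Q)=v(P)+r\cdot\Big(\sum_{t=1}^T E_P\big[\,\big|E_P[\partial_{x_t}f(X,a^\ast(X))\mid\mathcal F_t^X]\big|^q\,\big]\Big)^{1/q}+o(r).$$ -/

import Mathlib

open MeasureTheory ProbabilityTheory Filter Topology Asymptotics
open scoped ENNReal

noncomputable section

namespace AdaptedOpt

/-- `F_k = σ(X_1, …, X_k)` on the path space `ℝ^T`, for the canonical process `X`. Coordinates are
indexed by `Fin T`, so `X_1, …, X_k` are the coordinates with index `< k`; `F_0` is trivial. -/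
@[reducible] def pathSigma (T k : ℕ) : MeasurableSpace (Fin T → ℝ) :=
  ⨆ s : Fin T, ⨆ _ : (s : ℕ) < k, MeasurableSpace.comap (fun x : Fin T → ℝ => x s) inferInstance

theorem pathSigma_le (T k : ℕ) : pathSigma T k ≤ MeasurableSpace.pi :=
  iSup_le fun s => iSup_le fun _ => (measurable_pi_apply s).comap_le

/-- `P` is a Borel probability measure on `ℝ^T` with finite `p`-th moment. -/
def IsModel (T : ℕ) (p : ℝ) (P : Measure (Fin T → ℝ)) : Prop :=
  IsProbabilityMeasure P ∧ ∫⁻ x, ∑ t, ENNReal.ofReal (|x t| ^ p) ∂P < ∞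

/-- `π` is a coupling of `P` and `Q`. -/
def IsCoupling {T : ℕ} (π : Measure ((Fin T → ℝ) × (Fin T → ℝ))) (P Q : Measure (Fin T → ℝ)) :
    Prop :=
  π.map Prod.fst = P ∧ π.map Prod.snd = Q

/-- Causality: `π((Y_1,…,Y_t) ∈ A | X_1,…,X_T) = π((Y_1,…,Y_t) ∈ A | X_1,…,X_t)` almost surely, for
all `1 ≤ t ≤ T`. The events `{(Y_1,…,Y_t) ∈ A}` are written as `{Y ∈ B}` with `B ∈ F_t`. -/
def IsCausal {T : ℕ} (π : Measure ((Fin T → ℝ) × (Fin T → ℝ))) : Prop :=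
  ∀ t : ℕ, 1 ≤ t → t ≤ T → ∀ B : Set (Fin T → ℝ), MeasurableSet[pathSigma T t] B →
    π[(Prod.snd ⁻¹' B).indicator (fun _ => (1 : ℝ)) | (pathSigma T T).comap Prod.fst]
      =ᵐ[π] π[(Prod.snd ⁻¹' B).indicator (fun _ => (1 : ℝ)) | (pathSigma T t).comap Prod.fst]

/-- Bicausality: causality also holds with the roles of `X` and `Y` reversed. -/
def IsBicausal {T : ℕ} (π : Measure ((Fin T → ℝ) × (Fin T → ℝ))) : Prop :=
  IsCausal π ∧ IsCausal (π.map Prod.swap)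

/-- The adapted Wasserstein distance of order `p`. -/
def adaptedW {T : ℕ} (p : ℝ) (P Q : Measure (Fin T → ℝ)) : ℝ≥0∞ :=
  ⨅ (π : Measure ((Fin T → ℝ) × (Fin T → ℝ))) (_ : IsCoupling π P Q ∧ IsBicausal π),
    (∑ t, ∫⁻ z, ENNReal.ofReal (|z.1 t - z.2 t| ^ p) ∂π) ^ (1 / p)

/-- The ball `B_r(P)` for the adapted Wasserstein distance. -/
def ball {T : ℕ} (p : ℝ) (P : Measure (Fin T → ℝ)) (r : ℝ) : Set (Measure (Fin T → ℝ)) :=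
  {Q | IsModel T p Q ∧ adaptedW p P Q ≤ ENNReal.ofReal r}

/-- The cube `[-L, L]^T`. -/
def cube (T : ℕ) (L : ℝ) : Set (Fin T → ℝ) := {a | ∀ t, |a t| ≤ L}

/-- The predictable controls bounded by `L`: the control in period `t` is a measurable function of
the strict past. (Index `t : Fin T` is period `t + 1`.) -/
def controls (T : ℕ) (L : ℝ) : Set ((Fin T → ℝ) → (Fin T → ℝ)) :=
  {a | (∀ t : Fin T, Measurable[pathSigma T t] fun x => a x t) ∧ ∀ x, a x ∈ cube T L}

/-- The value `E_Q[f(X, a(X))]` of a control. -/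
def cost {T : ℕ} (f : (Fin T → ℝ) → (Fin T → ℝ) → ℝ) (Q : Measure (Fin T → ℝ))
    (a : (Fin T → ℝ) → (Fin T → ℝ)) : ℝ :=
  ∫ x, f x (a x) ∂Q

/-- `v(Q) = inf_a E_Q[f(X, a(X))]`. -/
def value {T : ℕ} (L : ℝ) (f : (Fin T → ℝ) → (Fin T → ℝ) → ℝ) (Q : Measure (Fin T → ℝ)) : ℝ :=
  sInf (cost f Q '' controls T L)

/-- The partial derivative of `f(x, a)` in the `t`-th coordinate of `x`. -/
def partialX {T : ℕ} (f : (Fin T → ℝ) → (Fin T → ℝ) → ℝ) (t : Fin T) (x a : Fin T → ℝ) : ℝ :=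
  fderiv ℝ (fun y => f y a) x (Pi.single t 1)

/-- `E_P[∂_{x_t} f(X, a(X)) | F_t]`. (Index `t : Fin T` is period `t + 1`.) -/
def condPartial {T : ℕ} (f : (Fin T → ℝ) → (Fin T → ℝ) → ℝ) (P : Measure (Fin T → ℝ))
    (a : (Fin T → ℝ) → (Fin T → ℝ)) (t : Fin T) : (Fin T → ℝ) → ℝ :=
  P[fun x => partialX f t x (a x) | pathSigma T (t + 1)]

/-- The standing assumption on the cost `f` under the model `P`. -/
structure IsAdmissibleCost {T : ℕ} (p L : ℝ) (P : Measure (Fin T → ℝ))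
    (f : (Fin T → ℝ) → (Fin T → ℝ) → ℝ) : Prop where
  /-- `f(x, ·)` is convex. -/
  convex : ∀ x, ConvexOn ℝ (cube T L) (f x)
  /-- `f(x, ·)` is twice continuously differentiable. -/
  contDiff : ∀ x, ContDiff ℝ 2 (f x)
  /-- `∇²_a f(X, ·) ≥ ε(X) I` on the cube, almost surely, with `ε(X) > 0` almost surely. -/
  strong : ∃ ε : (Fin T → ℝ) → ℝ, (∀ᵐ x ∂P, 0 < ε x) ∧ ∀ᵐ x ∂P, ∀ a ∈ cube T L,
    ∀ z : Fin T → ℝ, ε x * ∑ t, z t ^ 2 ≤ fderiv ℝ (fderiv ℝ (f x)) a z z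
  /-- `f(·, a)` is differentiable. -/
  differentiable : ∀ a, Differentiable ℝ fun x => f x a
  /-- The partial derivatives in `x` are jointly continuous. -/
  continuous : ∀ t, Continuous fun z : (Fin T → ℝ) × (Fin T → ℝ) => partialX f t z.1 z.2
  /-- Growth of order `p - 1`. -/
  growth : ∃ c : ℝ, 0 < c ∧ ∀ x, ∀ a ∈ cube T L,
    ∑ s, |partialX f s x a| ≤ c * (1 + ∑ s, |x s| ^ (p - 1))

end AdaptedOpt

end

/-!
The expansion follows from two matching bounds, for an optimal control `a` under `P` and
`g_t = E_P[∂_{x_t} f(X, a(X)) | F_t]`.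

**The optimal control.** Convexity makes the midpoint of two controls a control, so the expected
midpoint gap `gap` of `f(X, ·)` between two nearly optimal controls is small
(`IsAdmissibleCost.integral_gap_le`). By the lower bound on the Hessian this gap dominates the
squared distance of the controls, almost surely. Hence minimizing sequences converge almost surely
along subsequences (`IsAdmissibleCost.ae_cauchySeq`, `IsAdmissibleCost.exists_subseq_tendsto`),
which gives existence and uniqueness of `a`, and its stability under perturbations of the model.

**Upper bound** (`IsAdmissibleCost.value_le_of_mem_ball`). Let `π` be a bicausal coupling of `P` and
`Q` of cost about `r`. Causality from `Y` to `X` makes `E_π[a(X) | Y]` a control, and by the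
conditional Jensen inequality it costs at most `E_π[f(Y, a(X))]`
(`IsCausal.exists_control_le`). Linearizing `f(·, a(X))` at `X` leaves the terms
`E_π[∂_{x_t} f(X, a(X)) (Y_t - X_t)]`. Causality from `X` to `Y` replaces the derivative by `g_t(X)`
(`IsCausal.integral_mul_eq`), and Hölder's inequality bounds their sum by
`r (∑ ‖g_t‖_q ^ q) ^ (1 / q)`. The remainder is at most `A(X) ‖Y - X‖ + K ‖Y - X‖ ^ p` with `A`
small in `L^q(P)` (`IsAdmissibleCost.exists_remainder_le`), so that it is `o(r)` uniformly in `π`.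

**Lower bound.** Let `Z` be adapted, bounded and Lipschitz with `∑ ‖Z_t‖_p ^ p ≤ 1`. For small `r`
the map `x ↦ x + r Z(x)` has an adapted inverse (`exists_isAdapted_leftInverse`); its graph is then a
bicausal coupling, and the law of `X + r Z(X)` lies in the ball of radius `r`
(`map_add_smul_mem_ball`). Nearly optimal controls for these laws converge to `a`, so the value
grows at least at rate `E_P[∑ ∂_{x_t} f(X, a(X)) Z_t(X)] = E_P[∑ g_t Z_t]`
(`IsAdmissibleCost.eventually_le_value_map`). Choosing `Z_t` close in `L^p(P)` to a multiple of
`sign(g_t) |g_t| ^ (q - 1)` brings this rate as close as desired to the upper bound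
(`IsAdmissibleCost.exists_direction`).
-/

noncomputable section

namespace AdaptedOpt

/-! ### The path filtration -/

/-- The path that agrees with `x` before time `k` and vanishes afterwards. It generates
`pathSigma T k`, so that being `pathSigma T k`-measurable means being a measurable function of
`truncate k x`. -/
def truncate {T : ℕ} (k : ℕ) (x : Fin T → ℝ) : Fin T → ℝ := fun s => if (s : ℕ) < k then x s else 0

theorem truncate_apply_of_lt {T k : ℕ} {s : Fin T} (h : (s : ℕ) < k) (x : Fin T → ℝ) :
    truncate k x s = x s := if_pos h

theorem continuous_truncate {T : ℕ} (k : ℕ) : Continuous (truncate k : (Fin T → ℝ) → _) := by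
  refine continuous_pi fun s => ?_
  by_cases h : (s : ℕ) < k
  · simpa [truncate, h] using continuous_apply s
  · simpa [truncate, h] using continuous_const

theorem norm_truncate_sub_le {T : ℕ} (k : ℕ) (x y : Fin T → ℝ) :
    ‖truncate k x - truncate k y‖ ≤ ‖x - y‖ := by
  refine (pi_norm_le_iff_of_nonneg (norm_nonneg _)).2 fun s => ?_
  by_cases h : (s : ℕ) < k
  · simpa [truncate, h] using norm_le_pi_norm (x - y) s
  · simp [truncate, h]

theorem measurable_coord {T k : ℕ} {s : Fin T} (h : (s : ℕ) < k) :
    Measurable[pathSigma T k] fun x : Fin T → ℝ => x s :=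
  measurable_iff_comap_le.2 (le_iSup₂_of_le s h le_rfl)

theorem measurable_truncate (T k : ℕ) :
    Measurable[pathSigma T k] (truncate k : (Fin T → ℝ) → _) := by
  refine @measurable_pi_lambda _ _ _ (pathSigma T k) _ _ fun s => ?_
  by_cases h : (s : ℕ) < k
  · simpa [truncate, h] using measurable_coord h
  · simp [truncate, h]

theorem pathSigma_eq_comap (T k : ℕ) :
    pathSigma T k = MeasurableSpace.comap (truncate k) MeasurableSpace.pi := by
  refine le_antisymm (iSup₂_le fun s h => ?_) (measurable_truncate T k).comap_le
  rintro _ ⟨B, hB, rfl⟩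
  exact ⟨(fun x : Fin T → ℝ => x s) ⁻¹' B, measurable_pi_apply s hB, by
    ext x; simp [truncate_apply_of_lt h]⟩

theorem pathSigma_mono (T : ℕ) {j k : ℕ} (h : j ≤ k) : pathSigma T j ≤ pathSigma T k :=
  iSup₂_le fun s hs => le_iSup₂_of_le s (hs.trans_le h) le_rfl

theorem pathSigma_self (T : ℕ) : pathSigma T T = MeasurableSpace.pi := by
  rw [pathSigma_eq_comap]
  have : (truncate T : (Fin T → ℝ) → _) = id := by
    ext x s; exact truncate_apply_of_lt s.2 x
  rw [this, MeasurableSpace.comap_id]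

theorem exists_eq_comp_truncate {T k : ℕ} {g : (Fin T → ℝ) → ℝ} (hg : Measurable[pathSigma T k] g) :
    ∃ g' : (Fin T → ℝ) → ℝ, Measurable g' ∧ g = g' ∘ truncate k := by
  rw [pathSigma_eq_comap] at hg
  exact hg.exists_eq_measurable_comp

theorem apply_truncate {T k : ℕ} {g : (Fin T → ℝ) → ℝ} (hg : Measurable[pathSigma T k] g)
    (x : Fin T → ℝ) : g (truncate k x) = g x := by
  obtain ⟨g', -, rfl⟩ := exists_eq_comp_truncate hg
  have : truncate k (truncate k x) = truncate k x := by
    ext s; by_cases h : (s : ℕ) < k <;> simp [truncate, h]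
  simp [this]

theorem measurable_of_apply_truncate {T k : ℕ} {g : (Fin T → ℝ) → ℝ} (hg : Measurable g)
    (h : ∀ x, g (truncate k x) = g x) : Measurable[pathSigma T k] g := by
  have : g = g ∘ truncate k := funext fun x => (h x).symm
  rw [this]
  exact hg.comp (measurable_truncate T k)

/-- A map of path space is adapted if it maps the first `k` coordinates to the first `k`
coordinates, for every `k`. -/
def IsAdapted {T : ℕ} (G : (Fin T → ℝ) → (Fin T → ℝ)) : Prop :=
  ∀ s : Fin T, Measurable[pathSigma T (s + 1)] fun x => G x s

theorem IsAdapted.measurable_pathSigma {T : ℕ} {G : (Fin T → ℝ) → (Fin T → ℝ)} (hG : IsAdapted G)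
    (k : ℕ) : Measurable[pathSigma T k, pathSigma T k] G := by
  refine measurable_iff_comap_le.2 ?_
  rw [pathSigma, MeasurableSpace.comap_iSup]
  refine iSup_le fun s => ?_
  rw [MeasurableSpace.comap_iSup]
  refine iSup_le fun hs => ?_
  rw [MeasurableSpace.comap_comp]
  exact ((hG s).comap_le).trans (pathSigma_mono T hs)

theorem IsAdapted.measurable {T : ℕ} {G : (Fin T → ℝ) → (Fin T → ℝ)} (hG : IsAdapted G) :
    Measurable G := by
  have := hG.measurable_pathSigma T
  rwa [pathSigma_self] at this

/-! ### Couplings carried by graphs -/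

/-- The coupling of `P` with its image under an adapted map `G` is causal: an event of `Y = G(X)` up
to time `t` is an event of `X` up to time `t`. -/
theorem isCausal_map_graph {T : ℕ} (P : Measure (Fin T → ℝ)) [IsFiniteMeasure P]
    {G : (Fin T → ℝ) → (Fin T → ℝ)} (hG : IsAdapted G) : IsCausal (P.map fun x => (x, G x)) := by
  intro t _ htT B hB
  set π := P.map fun x => (x, G x)
  have hGm : Measurable fun x => (x, G x) := measurable_id.prodMk hG.measurable
  have hB' : MeasurableSet[pathSigma T t] (G ⁻¹' B) := hG.measurable_pathSigma t hB
  have hae : (Prod.snd ⁻¹' B).indicator (fun _ => (1 : ℝ))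
      =ᵐ[π] (Prod.fst ⁻¹' (G ⁻¹' B)).indicator (fun _ => (1 : ℝ)) := by
    have hmeas : MeasurableSet {z : (Fin T → ℝ) × (Fin T → ℝ) |
        (Prod.snd ⁻¹' B).indicator (fun _ => (1 : ℝ)) z
          = (Prod.fst ⁻¹' (G ⁻¹' B)).indicator (fun _ => (1 : ℝ)) z} :=
      measurableSet_eq_fun
        (measurable_const.indicator (measurable_snd (pathSigma_le T t _ hB)))
        (measurable_const.indicator (measurable_fst (pathSigma_le T t _ hB')))
    refine (ae_map_iff hGm.aemeasurable hmeas).2 (Eventually.of_forall fun x => ?_)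
    by_cases hx : G x ∈ B <;> simp [Set.indicator, hx]
  have key : ∀ k, t ≤ k → π[(Prod.snd ⁻¹' B).indicator (fun _ => (1 : ℝ)) |
      (pathSigma T k).comap Prod.fst]
        =ᵐ[π] (Prod.fst ⁻¹' (G ⁻¹' B)).indicator (fun _ => (1 : ℝ)) := by
    intro k hk
    have hle : (pathSigma T k).comap (Prod.fst : (Fin T → ℝ) × (Fin T → ℝ) → _) ≤
        (inferInstance : MeasurableSpace ((Fin T → ℝ) × (Fin T → ℝ))) :=
      (MeasurableSpace.comap_mono (pathSigma_le T k)).trans measurable_fst.comap_le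
    refine (condExp_congr_ae hae).trans (Eventually.of_forall fun z => ?_)
    rw [condExp_of_stronglyMeasurable hle]
    · refine StronglyMeasurable.indicator stronglyMeasurable_const ?_
      exact ⟨_, pathSigma_mono T hk _ hB', rfl⟩
    · exact (integrable_const _).indicator (measurable_fst (pathSigma_le T t _ hB'))
  exact (key T htT).trans (key t le_rfl).symm

theorem isBicausal_map_graph {T : ℕ} (P : Measure (Fin T → ℝ)) [IsFiniteMeasure P]
    {G H : (Fin T → ℝ) → (Fin T → ℝ)} (hG : IsAdapted G) (hH : IsAdapted H)
    (hHG : ∀ x, H (G x) = x) : IsBicausal (P.map fun x => (x, G x)) := by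
  refine ⟨isCausal_map_graph P hG, ?_⟩
  have hGm : Measurable fun x => (x, G x) := measurable_id.prodMk hG.measurable
  have hHm : Measurable fun y => (y, H y) := measurable_id.prodMk hH.measurable
  have : (P.map fun x => (x, G x)).map Prod.swap = (P.map G).map fun y => (y, H y) := by
    rw [Measure.map_map measurable_swap hGm, Measure.map_map hHm hG.measurable]
    congr 1
    ext x : 1
    simp [hHG]
  rw [this]
  exact isCausal_map_graph _ hH

theorem isCoupling_map_graph {T : ℕ} (P : Measure (Fin T → ℝ))
    {G : (Fin T → ℝ) → (Fin T → ℝ)} (hG : Measurable G) :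
    IsCoupling (P.map fun x => (x, G x)) P (P.map G) := by
  have h : Measurable fun x => (x, G x) := measurable_id.prodMk hG
  refine ⟨?_, ?_⟩
  · rw [Measure.map_map measurable_fst h]
    exact Measure.map_id
  · rw [Measure.map_map measurable_snd h]
    rfl

/-- An upper bound for the adapted distance of `P` to its image under an adapted map with an adapted
left inverse. -/
theorem adaptedW_map_le {T : ℕ} (p : ℝ) (P : Measure (Fin T → ℝ)) [IsFiniteMeasure P]
    {G H : (Fin T → ℝ) → (Fin T → ℝ)} (hG : IsAdapted G) (hH : IsAdapted H)
    (hHG : ∀ x, H (G x) = x) :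
    adaptedW p P (P.map G) ≤
      (∑ t, ∫⁻ x, ENNReal.ofReal (|x t - G x t| ^ p) ∂P) ^ (1 / p) := by
  refine (iInf₂_le (P.map fun x => (x, G x))
    ⟨isCoupling_map_graph P hG.measurable, isBicausal_map_graph P hG hH hHG⟩).trans_eq ?_
  congr 1
  refine Finset.sum_congr rfl fun t _ => ?_
  have hGm : Measurable fun x => (x, G x) := measurable_id.prodMk hG.measurable
  exact lintegral_map (by fun_prop) hGm

/-- A small Lipschitz adapted perturbation of the identity has an adapted inverse. The inverse exists
by the contraction principle; it is adapted because two paths whose images agree before time `k`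
differ, before time `k`, by at most a contraction of that same difference. -/
theorem exists_isAdapted_leftInverse {T : ℕ} {Z : (Fin T → ℝ) → (Fin T → ℝ)} (hZ : IsAdapted Z)
    {K : NNReal} (hK : K < 1) (hlip : LipschitzWith K Z) :
    ∃ H : (Fin T → ℝ) → (Fin T → ℝ), IsAdapted H ∧ ∀ x, H (x + Z x) = x := by
  set G : (Fin T → ℝ) → (Fin T → ℝ) := fun x => x + Z x with hG
  have happ : ApproximatesLinearOn G
      ((ContinuousLinearEquiv.refl ℝ (Fin T → ℝ) : (Fin T → ℝ) →L[ℝ] (Fin T → ℝ)))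
      Set.univ K := by
    refine ApproximatesLinearOn.approximatesLinearOn_iff_lipschitzOnWith.2 ?_
    have : G - ⇑(ContinuousLinearEquiv.refl ℝ (Fin T → ℝ) : (Fin T → ℝ) →L[ℝ] (Fin T → ℝ)) = Z := by
      ext x; simp [hG]
    rw [this]
    exact hlip.lipschitzOnWith
  have hc : Subsingleton (Fin T → ℝ) ∨
      K < ‖((ContinuousLinearEquiv.refl ℝ (Fin T → ℝ)).symm :
        (Fin T → ℝ) →L[ℝ] (Fin T → ℝ))‖₊⁻¹ := by
    rcases subsingleton_or_nontrivial (Fin T → ℝ) with h | h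
    · exact Or.inl h
    · refine Or.inr ?_
      have : ‖((ContinuousLinearEquiv.refl ℝ (Fin T → ℝ)).symm :
          (Fin T → ℝ) →L[ℝ] (Fin T → ℝ))‖₊ = 1 := NNReal.eq ContinuousLinearMap.norm_id
      rwa [this, inv_one]
  set e := happ.toHomeomorph G hc
  have he : ∀ x, e x = G x := fun x => rfl
  refine ⟨e.symm, fun s => ?_, fun x => e.symm_apply_apply x⟩
  refine measurable_of_apply_truncate
    ((continuous_apply s).comp e.symm.continuous).measurable fun y => ?_
  set x := e.symm y
  set x' := e.symm (truncate (s + 1) y)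
  have hx : G x = y := e.apply_symm_apply y
  have hx' : G x' = truncate (s + 1) y := e.apply_symm_apply _
  have hcoord : ∀ i : Fin T, (i : ℕ) < s + 1 → x' i - x i = Z x i - Z x' i := by
    intro i hi
    have h1 : G x i = y i := congrFun hx i
    have h2 : G x' i = y i := (congrFun hx' i).trans (truncate_apply_of_lt hi y)
    simp only [hG, Pi.add_apply] at h1 h2
    linarith
  have hZt : ∀ i : Fin T, (i : ℕ) < s + 1 → ∀ z, Z (truncate (s + 1) z) i = Z z i := fun i hi z =>
    apply_truncate ((hZ i).mono (pathSigma_mono T hi) le_rfl) z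
  set d := ‖truncate (s + 1) x' - truncate (s + 1) x‖
  have hd : d ≤ K * d := by
    refine (pi_norm_le_iff_of_nonneg (by positivity)).2 fun i => ?_
    by_cases hi : (i : ℕ) < s + 1
    · rw [Pi.sub_apply, truncate_apply_of_lt hi, truncate_apply_of_lt hi, hcoord i hi,
        ← hZt i hi x, ← hZt i hi x']
      refine (norm_le_pi_norm (Z (truncate (s + 1) x) - Z (truncate (s + 1) x')) i).trans ?_
      rw [norm_sub_rev]
      exact hlip.norm_sub_le _ _
    · simp only [Pi.sub_apply, truncate, if_neg hi, sub_zero, norm_zero]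
      positivity
  have hd0 : d = 0 := by
    have hK' : (K : ℝ) < 1 := hK
    nlinarith [norm_nonneg (truncate (s + 1) x' - truncate (s + 1) x)]
  have := congrFun (sub_eq_zero.1 (norm_eq_zero.1 hd0)) s
  rwa [truncate_apply_of_lt (Nat.lt_succ_self s), truncate_apply_of_lt (Nat.lt_succ_self s)] at this

/-! ### Controls -/

theorem cube_eq_pi (T : ℕ) (L : ℝ) : cube T L = Set.pi Set.univ fun _ => Set.Icc (-L) L := by
  ext x; simp only [cube, abs_le, Set.mem_ofPred_eq, Set.mem_univ_pi, Set.mem_Icc]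

theorem isCompact_cube (T : ℕ) (L : ℝ) : IsCompact (cube T L) := by
  rw [cube_eq_pi]
  exact isCompact_univ_pi fun _ => isCompact_Icc

theorem convex_cube (T : ℕ) (L : ℝ) : Convex ℝ (cube T L) := by
  rw [cube_eq_pi]
  exact convex_pi fun _ _ => convex_Icc _ _

theorem measurable_of_mem_controls {T : ℕ} {L : ℝ} {a : (Fin T → ℝ) → (Fin T → ℝ)}
    (ha : a ∈ controls T L) : Measurable a :=
  measurable_pi_lambda _ fun t => (ha.1 t).mono (pathSigma_le T t) le_rfl

/-! ### Conditional expectations under causal couplings -/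

section Abstract

variable {Ω : Type*} {m m' m0 : MeasurableSpace Ω} {μ : Measure Ω} [IsProbabilityMeasure μ]

/-- The conditional expectation is self-adjoint for the pairing of bounded with integrable
functions. -/
theorem integral_condExp_mul (hm : m ≤ m0) {W Z : Ω → ℝ} {C : ℝ} (hW : Integrable W μ)
    (hWC : ∀ ω, |W ω| ≤ C) (hZ : Integrable Z μ) :
    ∫ ω, (μ[W | m]) ω * Z ω ∂μ = ∫ ω, W ω * (μ[Z | m]) ω ∂μ := by
  have hbdd : ∀ᵐ ω ∂μ, |(μ[W | m]) ω| ≤ C :=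
    ae_bdd_abs_condExp_of_ae_bdd_abs (Eventually.of_forall hWC)
  have h1 : Integrable (μ[W | m] * Z) μ :=
    hZ.bdd_mul (integrable_condExp.aestronglyMeasurable) hbdd
  have h2 : Integrable (W * μ[Z | m]) μ :=
    integrable_condExp.bdd_mul hW.aestronglyMeasurable (Eventually.of_forall hWC)
  calc ∫ ω, (μ[W | m]) ω * Z ω ∂μ = ∫ ω, (μ[μ[W | m] * Z | m]) ω ∂μ := (integral_condExp hm).symm
    _ = ∫ ω, (μ[W | m] * μ[Z | m]) ω ∂μ :=
      integral_congr_ae (condExp_mul_of_stronglyMeasurable_left stronglyMeasurable_condExp h1 hZ)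
    _ = ∫ ω, (μ[W * μ[Z | m] | m]) ω ∂μ :=
      integral_congr_ae
        (condExp_mul_of_stronglyMeasurable_right stronglyMeasurable_condExp h2 hW).symm
    _ = ∫ ω, W ω * (μ[Z | m]) ω ∂μ := integral_condExp hm

/-- If conditioning `W` on the large σ-algebra `m'` only uses the information in `m`, then an
`m'`-measurable factor can be projected onto `m` when it is integrated against `W`. -/
theorem integral_mul_eq_of_condExp_eq (hm : m ≤ m') (hm' : m' ≤ m0) {W Z : Ω → ℝ} {C : ℝ}
    (hW : Integrable W μ) (hWC : ∀ ω, |W ω| ≤ C) (h : μ[W | m'] =ᵐ[μ] μ[W | m])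
    (hZm : StronglyMeasurable[m'] Z) (hZ : Integrable Z μ) :
    ∫ ω, W ω * Z ω ∂μ = ∫ ω, W ω * (μ[Z | m]) ω ∂μ := by
  rw [← integral_condExp_mul (hm.trans hm') hW hWC hZ]
  have h1 : Integrable (W * Z) μ := hZ.bdd_mul hW.aestronglyMeasurable (Eventually.of_forall hWC)
  calc ∫ ω, W ω * Z ω ∂μ = ∫ ω, (μ[W * Z | m']) ω ∂μ := (integral_condExp hm').symm
    _ = ∫ ω, (μ[W | m'] * Z) ω ∂μ :=
      integral_congr_ae (condExp_mul_of_stronglyMeasurable_right hZm h1 hW)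
    _ = ∫ ω, (μ[W | m]) ω * Z ω ∂μ := integral_congr_ae (h.mono fun ω hω => by simp [hω])

/-- Conditional expectations commute with a change of variables. -/
theorem condExp_comp_ae_eq {α : Type*} {n mα : MeasurableSpace α} {X : Ω → α} (hX : Measurable X)
    (hn : n ≤ mα) {Z : α → ℝ} (hZ : Integrable Z (μ.map X)) :
    μ[Z ∘ X | n.comap X] =ᵐ[μ] (μ.map X)[Z | n] ∘ X := by
  have : IsProbabilityMeasure (μ.map X) := Measure.isProbabilityMeasure_map hX.aemeasurable
  have hle : n.comap X ≤ m0 := (MeasurableSpace.comap_mono hn).trans hX.comap_le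
  have hint : Integrable ((μ.map X)[Z | n] ∘ X) μ := integrable_condExp.comp_measurable hX
  refine (ae_eq_condExp_of_forall_setIntegral_eq hle (hZ.comp_measurable hX)
    (fun s _ _ => hint.integrableOn) ?_ ?_).symm
  · rintro _ ⟨B, hB, rfl⟩ -
    have hB' := hn _ hB
    calc ∫ ω in X ⁻¹' B, ((μ.map X)[Z | n] ∘ X) ω ∂μ
        = ∫ x in B, ((μ.map X)[Z | n]) x ∂(μ.map X) :=
          (setIntegral_map hB' integrable_condExp.aestronglyMeasurable hX.aemeasurable).symm
      _ = ∫ x in B, Z x ∂(μ.map X) := setIntegral_condExp hn hZ hB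
      _ = ∫ ω in X ⁻¹' B, (Z ∘ X) ω ∂μ :=
          setIntegral_map hB' hZ.aestronglyMeasurable hX.aemeasurable
  · exact (stronglyMeasurable_condExp.comp_measurable
      (@comap_measurable _ _ n X)).aestronglyMeasurable

end Abstract

variable {T : ℕ} {π : Measure ((Fin T → ℝ) × (Fin T → ℝ))} [IsProbabilityMeasure π]

theorem comap_fst_le (T k : ℕ) : (pathSigma T k).comap
    (Prod.fst : (Fin T → ℝ) × (Fin T → ℝ) → _) ≤ Prod.instMeasurableSpace :=
  (MeasurableSpace.comap_mono (pathSigma_le T k)).trans measurable_fst.comap_le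

theorem comap_snd_le (T k : ℕ) : (pathSigma T k).comap
    (Prod.snd : (Fin T → ℝ) × (Fin T → ℝ) → _) ≤ Prod.instMeasurableSpace :=
  (MeasurableSpace.comap_mono (pathSigma_le T k)).trans measurable_snd.comap_le

/-- Under a causal coupling, a function of `X` can be replaced by its conditional expectation given
`X_1, …, X_t` when it is integrated against a function of `Y_1, …, Y_t`. -/
theorem IsCausal.integral_mul_eq (hπ : IsCausal π) {t : ℕ} (ht : 1 ≤ t) (htT : t ≤ T)
    {Z φ : (Fin T → ℝ) → ℝ} (hZm : Measurable Z) (hZ : Integrable Z (π.map Prod.fst))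
    (hφ : Measurable[pathSigma T t] φ)
    (h1 : Integrable (fun z => Z z.1 * φ z.2) π)
    (h2 : Integrable (fun z => ((π.map Prod.fst)[Z | pathSigma T t]) z.1 * φ z.2) π) :
    ∫ z, Z z.1 * φ z.2 ∂π = ∫ z, ((π.map Prod.fst)[Z | pathSigma T t]) z.1 * φ z.2 ∂π := by
  set g := (π.map Prod.fst)[Z | pathSigma T t]
  have hmY := comap_snd_le T t
  have hZi : Integrable (Z ∘ Prod.fst) π := hZ.comp_measurable measurable_fst
  have hgi : Integrable (g ∘ Prod.fst) π := integrable_condExp.comp_measurable measurable_fst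
  have hZT : StronglyMeasurable[(pathSigma T T).comap Prod.fst]
      (Z ∘ Prod.fst : (Fin T → ℝ) × (Fin T → ℝ) → ℝ) := by
    rw [pathSigma_self]
    exact hZm.stronglyMeasurable.comp_measurable (comap_measurable _)
  have hφY : StronglyMeasurable[(pathSigma T t).comap Prod.snd] (φ ∘ Prod.snd : (Fin T → ℝ) × (Fin T → ℝ) → ℝ) :=
    hφ.stronglyMeasurable.comp_measurable (comap_measurable _)
  have hcond : π[Z ∘ Prod.fst | (pathSigma T t).comap Prod.snd] =ᵐ[π] π[g ∘ Prod.fst | (pathSigma T t).comap Prod.snd] := by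
    refine ae_eq_condExp_of_forall_setIntegral_eq hmY hgi
      (fun s _ _ => integrable_condExp.integrableOn) ?_
      stronglyMeasurable_condExp.aestronglyMeasurable
    rintro s ⟨B, hB, rfl⟩ -
    rw [setIntegral_condExp hmY hZi ⟨B, hB, rfl⟩]
    have hBm : MeasurableSet (Prod.snd ⁻¹' B : Set ((Fin T → ℝ) × (Fin T → ℝ))) :=
      measurable_snd (pathSigma_le T t _ hB)
    have hind : ∀ w : (Fin T → ℝ) × (Fin T → ℝ) → ℝ,
        ∫ z in Prod.snd ⁻¹' B, w z ∂π
          = ∫ z, (Prod.snd ⁻¹' B).indicator (fun _ => (1 : ℝ)) z * w z ∂π := by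
      intro w
      rw [← integral_indicator hBm]
      congr 1
      ext z
      by_cases hz : z ∈ (Prod.snd ⁻¹' B : Set ((Fin T → ℝ) × (Fin T → ℝ))) <;> simp [hz]
    rw [hind, hind]
    rw [integral_mul_eq_of_condExp_eq (C := 1)
      (MeasurableSpace.comap_mono (pathSigma_mono T htT)) (comap_fst_le T T)
      ((integrable_const _).indicator hBm) (fun z => ?_) (hπ t ht htT B hB) hZT hZi]
    · refine integral_congr_ae ?_
      filter_upwards [condExp_comp_ae_eq measurable_fst (pathSigma_le T t) hZ] with z hz
      rw [hz]
    · by_cases hz : z ∈ (Prod.snd ⁻¹' B : Set ((Fin T → ℝ) × (Fin T → ℝ))) <;> simp [hz]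
  calc ∫ z, Z z.1 * φ z.2 ∂π = ∫ z, (π[(Z ∘ Prod.fst : (Fin T → ℝ) × (Fin T → ℝ) → ℝ) * (φ ∘ Prod.snd) |
        (pathSigma T t).comap Prod.snd]) z ∂π :=
      (integral_condExp hmY).symm
    _ = ∫ z, (π[Z ∘ Prod.fst | (pathSigma T t).comap Prod.snd]) z * φ z.2 ∂π :=
      integral_congr_ae (condExp_mul_of_stronglyMeasurable_right hφY h1 hZi)
    _ = ∫ z, (π[g ∘ Prod.fst | (pathSigma T t).comap Prod.snd]) z * φ z.2 ∂π :=
      integral_congr_ae (hcond.mono fun z hz => by simp only [hz])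
    _ = ∫ z, (π[(g ∘ Prod.fst : (Fin T → ℝ) × (Fin T → ℝ) → ℝ) * (φ ∘ Prod.snd) |
        (pathSigma T t).comap Prod.snd]) z ∂π :=
      integral_congr_ae (condExp_mul_of_stronglyMeasurable_right (f := g ∘ Prod.fst) hφY h2 hgi).symm
    _ = ∫ z, g z.1 * φ z.2 ∂π := integral_condExp hmY

/-- Causality for bounded functions of `Y_1, …, Y_t` instead of events. At `t = 0` such functions
are constant, so that the statement does not need causality. -/
theorem IsCausal.condExp_eq (hπ : IsCausal π) {t : ℕ} (htT : t ≤ T)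
    {φ : (Fin T → ℝ) → ℝ} (hφ : Measurable[pathSigma T t] φ) {C : ℝ} (hC : ∀ x, |φ x| ≤ C) :
    π[φ ∘ Prod.snd | (pathSigma T T).comap Prod.fst]
      =ᵐ[π] π[φ ∘ Prod.snd | (pathSigma T t).comap Prod.fst] := by
  rcases Nat.eq_zero_or_pos t with rfl | ht
  · have : (φ ∘ Prod.snd : (Fin T → ℝ) × (Fin T → ℝ) → ℝ) = fun _ => φ 0 := by
      ext z
      rw [Function.comp_apply, ← apply_truncate hφ]
      congr 1
    rw [this, condExp_const (comap_fst_le T T), condExp_const (comap_fst_le T 0)]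
  have hφm : Measurable φ := hφ.mono (pathSigma_le T t) le_rfl
  have hφi : Integrable (φ ∘ Prod.snd) π :=
    Integrable.of_bound (hφm.comp measurable_snd).aestronglyMeasurable C
      (Eventually.of_forall fun z => hC _)
  refine (ae_eq_condExp_of_forall_setIntegral_eq (comap_fst_le T T) hφi
    (fun s _ _ => integrable_condExp.integrableOn) ?_
    (stronglyMeasurable_condExp.mono
      (MeasurableSpace.comap_mono (pathSigma_mono T htT))).aestronglyMeasurable).symm
  rintro s ⟨B, hB, rfl⟩ -
  have hBm : MeasurableSet B := pathSigma_le T T _ hB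
  have hprob : IsProbabilityMeasure (π.map Prod.fst) :=
    Measure.isProbabilityMeasure_map measurable_fst.aemeasurable
  set Z : (Fin T → ℝ) → ℝ := B.indicator fun _ => 1 with hZdef
  have hZm : Measurable Z := measurable_const.indicator hBm
  have hZb : ∀ x, |Z x| ≤ 1 := fun x => by by_cases hx : x ∈ B <;> simp [hZdef, hx]
  have hZ : Integrable Z (π.map Prod.fst) := (integrable_const _).indicator hBm
  have hZi : Integrable (Z ∘ Prod.fst) π := hZ.comp_measurable measurable_fst
  have hind : ∀ w : (Fin T → ℝ) × (Fin T → ℝ) → ℝ,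
      ∫ z in Prod.fst ⁻¹' B, w z ∂π = ∫ z, (Z ∘ Prod.fst) z * w z ∂π := by
    intro w
    rw [← integral_indicator (measurable_fst hBm)]
    congr 1
    ext z
    by_cases hz : z.1 ∈ B <;> simp [hz, hZdef]
  rw [hind, hind, ← integral_condExp_mul (comap_fst_le T t) hZi (fun z => hZb _) hφi]
  have hce := condExp_comp_ae_eq measurable_fst (pathSigma_le T t) hZ
  have h2 : Integrable (fun z => ((π.map Prod.fst)[Z | pathSigma T t]) z.1 * φ z.2) π :=
    ((integrable_condExp.comp_measurable measurable_fst).bdd_mul hφi.aestronglyMeasurable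
      (Eventually.of_forall fun z => hC z.2)).congr
      (Eventually.of_forall fun z => mul_comm _ _)
  have h1 : Integrable (fun z => Z z.1 * φ z.2) π :=
    hφi.bdd_mul hZi.aestronglyMeasurable (Eventually.of_forall fun z => hZb z.1)
  calc ∫ z, (π[Z ∘ Prod.fst | (pathSigma T t).comap Prod.fst]) z * (φ ∘ Prod.snd) z ∂π
      = ∫ z, ((π.map Prod.fst)[Z | pathSigma T t]) z.1 * φ z.2 ∂π :=
        integral_congr_ae (hce.mono fun z hz => by simp only [hz, Function.comp_apply])
    _ = ∫ z, (Z ∘ Prod.fst) z * (φ ∘ Prod.snd) z ∂π :=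
        (hπ.integral_mul_eq ht htT hZm hZ hφ h1 h2).symm

/-- Along a causal coupling, a control `a` of the second process can be projected to a control of
the first one, namely to the conditional expectation of `a(Y)` given `X`: it is bounded by the same
constant, causality makes it predictable, and it costs no more by the conditional Jensen
inequality. -/
theorem IsCausal.exists_control_le (hπ : IsCausal π) {L : ℝ} (hL : 0 ≤ L)
    {f : (Fin T → ℝ) → (Fin T → ℝ) → ℝ} (hfm : Measurable (Function.uncurry f))
    (hconv : ∀ x, ConvexOn ℝ (cube T L) (f x)) (hcont : ∀ x, Continuous (f x))
    (hint : ∀ A : (Fin T → ℝ) × (Fin T → ℝ) → (Fin T → ℝ), Measurable A →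
      (∀ z, A z ∈ cube T L) → Integrable (fun z => f z.1 (A z)) π)
    {a : (Fin T → ℝ) → (Fin T → ℝ)} (ha : a ∈ controls T L) :
    ∃ b ∈ controls T L, ∫ z, f z.1 (b z.1) ∂π ≤ ∫ z, f z.1 (a z.2) ∂π := by
  have ham := measurable_of_mem_controls ha
  have hai : ∀ t, Integrable (fun z => a z.2 t) π := fun t =>
    Integrable.of_bound (((measurable_pi_apply t).comp ham).comp
      measurable_snd).aestronglyMeasurable L (Eventually.of_forall fun z => ha.2 z.2 t)
  have hex : ∀ t : Fin T, ∃ β : (Fin T → ℝ) → ℝ, Measurable[pathSigma T t] β ∧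
      π[(fun x => a x t) ∘ Prod.snd | (pathSigma T t).comap Prod.fst] = β ∘ Prod.fst := fun t =>
    have h : Measurable[(pathSigma T t).comap Prod.fst]
        (π[(fun x => a x t) ∘ Prod.snd | (pathSigma T t).comap Prod.fst]) :=
      stronglyMeasurable_condExp.measurable
    Measurable.exists_eq_measurable_comp (mY := pathSigma T t) h
  choose β hβm hβ using hex
  -- Conditional expectations are bounded by `L` only almost surely; clamping gives a control.
  set b : (Fin T → ℝ) → (Fin T → ℝ) := fun x t => max (-L) (min L (β t x)) with hb
  have hbc : b ∈ controls T L := by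
    refine ⟨fun t => ?_, fun x t => ?_⟩
    · exact (by fun_prop : Measurable fun u : ℝ => max (-L) (min L u)).comp (hβm t)
    · exact abs_le.2 ⟨le_max_left _ _, max_le (by linarith) (min_le_left _ _)⟩
  have hbm := measurable_of_mem_controls hbc
  refine ⟨b, hbc, ?_⟩
  set κ := condDistrib (Prod.snd : (Fin T → ℝ) × (Fin T → ℝ) → _) Prod.fst π
  have hbint : ∀ᵐ z ∂π, ∀ t, b z.1 t = ∫ y, a y t ∂(κ z.1) := by
    refine ae_all_iff.2 fun t => ?_
    have h1 := hπ.condExp_eq t.2.le (ha.1 t) (fun x => ha.2 x t)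
    have h2 := condExp_ae_eq_integral_condDistrib (μ := π) measurable_fst
      measurable_snd.aemeasurable (((measurable_pi_apply t).comp ham).stronglyMeasurable) (hai t)
    have hbd := ae_bdd_abs_condExp_of_ae_bdd_abs (m := (pathSigma T t).comap Prod.fst) (R := L)
      (f := (fun x => a x t) ∘ Prod.snd) (μ := π) (Eventually.of_forall fun z => ha.2 z.2 t)
    rw [pathSigma_self] at h1
    filter_upwards [h1, h2, hbd] with z h1 h2 h3
    have h2' := h1.symm.trans h2
    rw [hβ t] at h2' h3
    have h3' := abs_le.1 h3
    exact (congrArg (max (-L)) (min_eq_right h3'.2)).trans ((max_eq_right h3'.1).trans h2')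
  have hfa : Measurable fun z : (Fin T → ℝ) × (Fin T → ℝ) => f z.1 (a z.2) :=
    hfm.comp (measurable_fst.prodMk (ham.comp measurable_snd))
  have hia := hint (fun z => a z.2) (ham.comp measurable_snd) fun z => ha.2 _
  have hib := hint (fun z => b z.1) (hbm.comp measurable_fst) fun z => hbc.2 _
  have hce := condExp_prod_ae_eq_integral_condDistrib (μ := π) measurable_fst
    measurable_snd.aemeasurable hfa.stronglyMeasurable hia
  rw [← integral_condExp (measurable_fst.comap_le) (f := fun z => f z.1 (a z.2))]
  refine integral_mono_ae hib integrable_condExp ?_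
  filter_upwards [hce, hbint] with z hz hbz
  refine le_of_le_of_eq ?_ hz.symm
  have hcpt := isCompact_cube T L
  have hmeas : ∀ t, Integrable (fun y => a y t) (κ z.1) := fun t =>
    Integrable.of_bound ((measurable_pi_apply t).comp ham).aestronglyMeasurable L
      (Eventually.of_forall fun y => ha.2 y t)
  have hbz' : b z.1 = ∫ y, a y ∂(κ z.1) := by
    ext t
    rw [hbz t, eval_integral hmeas]
  obtain ⟨C, hC⟩ := hcpt.exists_bound_of_continuousOn (hcont z.1).continuousOn
  rw [hbz']
  refine (hconv z.1).map_integral_le (hcont z.1).continuousOn hcpt.isClosed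
    (Eventually.of_forall ha.2) (Integrable.of_eval hmeas) ?_
  exact Integrable.of_bound ((hcont z.1).measurable.comp ham).aestronglyMeasurable C
    (Eventually.of_forall fun y => hC _ (ha.2 y))

/-! ### Moments -/

theorem add_rpow_le {s u v : ℝ} (hs : 0 ≤ s) (hu : 0 ≤ u) (hv : 0 ≤ v) :
    (u + v) ^ s ≤ 2 ^ s * (u ^ s + v ^ s) := by
  have h1 : (u + v) ^ s ≤ (2 * max u v) ^ s :=
    Real.rpow_le_rpow (by positivity) (by linarith [le_max_left u v, le_max_right u v]) hs
  rw [Real.mul_rpow (by norm_num) (hu.trans (le_max_left u v))] at h1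
  refine h1.trans (mul_le_mul_of_nonneg_left ?_ (by positivity))
  have hu' : 0 ≤ u ^ s := by positivity
  have hv' : 0 ≤ v ^ s := by positivity
  rcases max_choice u v with h | h <;> rw [h] <;> linarith

theorem norm_rpow_le_sum {T : ℕ} {s : ℝ} (hs : 0 < s) (x : Fin T → ℝ) :
    ‖x‖ ^ s ≤ ∑ t, |x t| ^ s := by
  have h0 : 0 ≤ ∑ t, |x t| ^ s := Finset.sum_nonneg fun t _ => by positivity
  have : ‖x‖ ≤ (∑ t, |x t| ^ s) ^ s⁻¹ := by
    refine (pi_norm_le_iff_of_nonneg (by positivity)).2 fun t => ?_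
    rw [Real.norm_eq_abs, Real.le_rpow_inv_iff_of_pos (abs_nonneg _) h0 hs]
    exact Finset.single_le_sum (f := fun t => |x t| ^ s) (fun t _ => by positivity)
      (Finset.mem_univ t)
  rwa [Real.le_rpow_inv_iff_of_pos (norm_nonneg _) h0 hs] at this

theorem sum_rpow_le_norm {T : ℕ} {s : ℝ} (hs : 0 ≤ s) (x : Fin T → ℝ) :
    ∑ t, |x t| ^ s ≤ T * ‖x‖ ^ s := by
  have : ∀ t ∈ Finset.univ, |x t| ^ s ≤ ‖x‖ ^ s := fun t _ =>
    Real.rpow_le_rpow (abs_nonneg _) (norm_le_pi_norm x t) hs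
  simpa using Finset.sum_le_sum this

theorem IsModel.integrable_norm_rpow {T : ℕ} {p : ℝ} (hp : 0 < p) {P : Measure (Fin T → ℝ)}
    (hP : IsModel T p P) : Integrable (fun x => ‖x‖ ^ p) P := by
  have := hP.1
  refine ⟨(measurable_norm.pow_const p).aestronglyMeasurable, ?_⟩
  refine lt_of_le_of_lt (lintegral_mono fun x => ?_) hP.2
  rw [Real.enorm_eq_ofReal (by positivity), ← ENNReal.ofReal_sum_of_nonneg fun t _ => by positivity]
  exact ENNReal.ofReal_le_ofReal (norm_rpow_le_sum hp x)

theorem isModel_of_integrable {T : ℕ} {p : ℝ} (hp : 0 < p) {P : Measure (Fin T → ℝ)}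
    (hP : IsProbabilityMeasure P) (h : Integrable (fun x => ‖x‖ ^ p) P) : IsModel T p P := by
  refine ⟨hP, ?_⟩
  refine lt_of_le_of_lt (lintegral_mono (g := fun x => ‖(T : ℝ) * ‖x‖ ^ p‖ₑ) fun x => ?_)
    (h.const_mul (T : ℝ)).2
  simp only
  rw [Real.enorm_eq_ofReal (by positivity), ← ENNReal.ofReal_sum_of_nonneg fun t _ => by positivity]
  exact ENNReal.ofReal_le_ofReal (sum_rpow_le_norm hp.le x)

section Moments

variable {T : ℕ} {Ω : Type*} [MeasurableSpace Ω] {ρ : Measure Ω}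
  {X Y : Ω → (Fin T → ℝ)} {p q : ℝ}

theorem memLp_of_integrable_norm_rpow (hp : 1 < p) (hX : Measurable X)
    (h : Integrable (fun ω => ‖X ω‖ ^ p) ρ) : MemLp X (ENNReal.ofReal p) ρ := by
  have hp0 : 0 < p := by linarith
  have := (integrable_norm_rpow_iff (μ := ρ) (f := X) (p := ENNReal.ofReal p)
    hX.aestronglyMeasurable (by simpa using hp0) ENNReal.ofReal_ne_top).1
  rw [ENNReal.toReal_ofReal hp0.le] at this
  exact this h

theorem memLp_norm_rpow_sub_one (hpq : p.HolderConjugate q) (hX : Measurable X)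
    (h : Integrable (fun ω => ‖X ω‖ ^ p) ρ) :
    MemLp (fun ω => ‖X ω‖ ^ (p - 1)) (ENNReal.ofReal q) ρ := by
  have h1 := hpq.sub_one_pos
  have h2 := (memLp_of_integrable_norm_rpow hpq.lt hX h).norm_rpow_div (ENNReal.ofReal (p - 1))
  rw [ENNReal.toReal_ofReal h1.le, ← ENNReal.ofReal_div_of_pos h1, ← hpq.conjugate_eq] at h2
  exact h2

theorem integrable_norm_add_rpow (hp : 1 < p) (hX : Measurable X) (hY : Measurable Y)
    (h : Integrable (fun ω => ‖X ω‖ ^ p) ρ) (h' : Integrable (fun ω => ‖Y ω‖ ^ p) ρ) :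
    Integrable (fun ω => ‖X ω + Y ω‖ ^ p) ρ := by
  refine ((h.add h').const_mul (2 ^ p)).mono'
    ((hX.add hY).norm.pow_const p).aestronglyMeasurable (Eventually.of_forall fun ω => ?_)
  rw [Real.norm_of_nonneg (by positivity)]
  refine (Real.rpow_le_rpow (norm_nonneg _) (norm_add_le _ _) (by linarith)).trans ?_
  exact add_rpow_le (by linarith) (norm_nonneg _) (norm_nonneg _)

end Moments

/-! ### Growth and regularity of the cost -/

section Cost

variable {T : ℕ} {p q L : ℝ} {P : Measure (Fin T → ℝ)} {f : (Fin T → ℝ) → (Fin T → ℝ) → ℝ}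

theorem zero_mem_cube (hL : 0 ≤ L) : (0 : Fin T → ℝ) ∈ cube T L := fun t => by simpa using hL

theorem const_zero_mem_controls (hL : 0 ≤ L) :
    (fun _ => 0 : (Fin T → ℝ) → (Fin T → ℝ)) ∈ controls T L :=
  ⟨fun _ => measurable_const, fun _ => zero_mem_cube hL⟩

theorem fderiv_apply_eq_sum (f : (Fin T → ℝ) → (Fin T → ℝ) → ℝ) (x a h : Fin T → ℝ) :
    fderiv ℝ (fun y => f y a) x h = ∑ t, partialX f t x a * h t := by
  conv_lhs => rw [← Finset.univ_sum_single h]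
  rw [map_sum]
  refine Finset.sum_congr rfl fun t _ => ?_
  have : (Pi.single t (h t) : Fin T → ℝ) = h t • Pi.single t 1 := by
    rw [← Pi.single_smul, smul_eq_mul, mul_one]
  rw [this, map_smul, smul_eq_mul, mul_comm, partialX]

theorem norm_fderiv_le_sum (f : (Fin T → ℝ) → (Fin T → ℝ) → ℝ) (x a : Fin T → ℝ) :
    ‖fderiv ℝ (fun y => f y a) x‖ ≤ ∑ t, |partialX f t x a| := by
  refine ContinuousLinearMap.opNorm_le_bound _ (Finset.sum_nonneg fun t _ => abs_nonneg _)
    fun h => ?_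
  rw [fderiv_apply_eq_sum, Finset.sum_mul]
  refine (norm_sum_le _ _).trans (Finset.sum_le_sum fun t _ => ?_)
  rw [norm_mul]
  exact mul_le_mul_of_nonneg_left (norm_le_pi_norm h t) (abs_nonneg _)

theorem IsAdmissibleCost.exists_growth (hf : IsAdmissibleCost p L P f) (hp : 1 < p) :
    ∃ C : ℝ, 0 ≤ C ∧ ∀ x, ∀ a ∈ cube T L,
      ∑ s, |partialX f s x a| ≤ C * (1 + ‖x‖ ^ (p - 1)) := by
  obtain ⟨c, hc, h⟩ := hf.growth
  refine ⟨c * (1 + T), by positivity, fun x a ha => (h x a ha).trans ?_⟩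
  rw [mul_assoc]
  refine mul_le_mul_of_nonneg_left ?_ hc.le
  have h1 := sum_rpow_le_norm (by linarith : 0 ≤ p - 1) x
  have h2 : 0 ≤ ‖x‖ ^ (p - 1) := by positivity
  have h3 : (0 : ℝ) ≤ T := by positivity
  nlinarith

/-- Increments of the cost in `x`, by the mean value inequality on the segment from `x` to
`x + h`. -/
theorem IsAdmissibleCost.exists_increment (hf : IsAdmissibleCost p L P f) (hp : 1 < p) :
    ∃ C : ℝ, 0 ≤ C ∧ (∀ x, ∀ a ∈ cube T L, ∑ s, |partialX f s x a| ≤ C * (1 + ‖x‖ ^ (p - 1))) ∧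
      ∀ x h, ∀ a ∈ cube T L,
        |f (x + h) a - f x a| ≤ C * (1 + ‖x‖ ^ (p - 1) + ‖h‖ ^ (p - 1)) * ‖h‖ := by
  obtain ⟨C, hC, hgr⟩ := hf.exists_growth hp
  have hp1 : 0 ≤ p - 1 := by linarith
  have h2p : (1 : ℝ) ≤ 2 ^ (p - 1) := Real.one_le_rpow (by norm_num) hp1
  refine ⟨C * 2 ^ (p - 1), by positivity, fun x a ha => (hgr x a ha).trans ?_,
    fun x h a ha => ?_⟩
  · refine mul_le_mul_of_nonneg_right ?_ (by positivity)
    nlinarith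
  have hseg : ∀ z ∈ segment ℝ x (x + h), ‖fderiv ℝ (fun y => f y a) z‖ ≤
      C * 2 ^ (p - 1) * (1 + ‖x‖ ^ (p - 1) + ‖h‖ ^ (p - 1)) := by
    intro z hz
    refine (norm_fderiv_le_sum f z a).trans ((hgr z a ha).trans ?_)
    rw [mul_assoc]
    refine mul_le_mul_of_nonneg_left ?_ hC
    have hzn : ‖z‖ ≤ ‖x‖ + ‖h‖ := by
      rw [segment_eq_image'] at hz
      obtain ⟨θ, ⟨h0, h1⟩, rfl⟩ := hz
      refine (norm_add_le _ _).trans (add_le_add_right ?_ _)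
      rw [add_sub_cancel_left, norm_smul, Real.norm_of_nonneg h0]
      exact mul_le_of_le_one_left (norm_nonneg _) h1
    have h1 := Real.rpow_le_rpow (norm_nonneg _) hzn hp1
    have h2 := add_rpow_le hp1 (norm_nonneg x) (norm_nonneg h)
    nlinarith
  have := (convex_segment x (x + h)).norm_image_sub_le_of_norm_fderiv_le
    (fun z _ => hf.differentiable a z) hseg (left_mem_segment ℝ x (x + h))
    (right_mem_segment ℝ x (x + h))
  simpa using this

theorem IsAdmissibleCost.exists_bound (hf : IsAdmissibleCost p L P f) (hp : 1 < p) :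
    ∃ C : ℝ, 0 ≤ C ∧ ∀ x, ∀ a ∈ cube T L, |f x a| ≤ C * (1 + ‖x‖ ^ p) := by
  obtain ⟨C, hC, -, hinc⟩ := hf.exists_increment hp
  obtain ⟨M, hM⟩ := (isCompact_cube T L).exists_bound_of_continuousOn
    (hf.contDiff 0).continuous.continuousOn
  refine ⟨|M| + 2 * C, by positivity, fun x a ha => ?_⟩
  have h1 := hinc 0 x a ha
  have h2 : |f 0 a| ≤ |M| := (hM a ha).trans (le_abs_self M)
  rw [zero_add, norm_zero, Real.zero_rpow (by linarith), add_zero] at h1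
  have h3 : |f x a| ≤ |f x a - f 0 a| + |f 0 a| := by
    simpa using abs_add_le (f x a - f 0 a) (f 0 a)
  have h4 : ‖x‖ ^ (p - 1) * ‖x‖ = ‖x‖ ^ p := by
    rw [← Real.rpow_add_one' (norm_nonneg x) (by linarith), sub_add_cancel]
  have h5 : ‖x‖ ≤ 1 + ‖x‖ ^ p := by
    rcases le_total ‖x‖ 1 with h | h
    · have : 0 ≤ ‖x‖ ^ p := by positivity
      linarith
    · have := Real.self_le_rpow_of_one_le h hp.le
      linarith
  have h6 : 0 ≤ ‖x‖ ^ p := by positivity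
  have h7 : C * (1 + ‖x‖ ^ (p - 1)) * ‖x‖ = C * (‖x‖ + ‖x‖ ^ p) := by rw [← h4]; ring
  rw [h7] at h1
  have h8 : C * (‖x‖ + ‖x‖ ^ p) ≤ C * (2 * (1 + ‖x‖ ^ p)) :=
    mul_le_mul_of_nonneg_left (by linarith) hC
  nlinarith [abs_nonneg M]

theorem IsAdmissibleCost.measurable_uncurry (hf : IsAdmissibleCost p L P f) :
    Measurable (Function.uncurry f) := by
  have := measurable_uncurry_of_continuous_of_measurable (u := fun a x => f x a)
    (fun x => (hf.contDiff x).continuous) (fun a => (hf.differentiable a).continuous.measurable)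
  exact this.comp measurable_swap

section Integrability

variable {Ω : Type*} [MeasurableSpace Ω] {ρ : Measure Ω} [IsProbabilityMeasure ρ]
  {X A : Ω → (Fin T → ℝ)}

theorem IsAdmissibleCost.measurable_comp (hf : IsAdmissibleCost p L P f) (hX : Measurable X)
    (hA : Measurable A) : Measurable fun ω => f (X ω) (A ω) :=
  hf.measurable_uncurry.comp (hX.prodMk hA)

theorem IsAdmissibleCost.measurable_partialX (hf : IsAdmissibleCost p L P f) (hX : Measurable X)
    (hA : Measurable A) (t : Fin T) : Measurable fun ω => partialX f t (X ω) (A ω) :=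
  (hf.continuous t).measurable.comp (hX.prodMk hA)

theorem IsAdmissibleCost.integrable_comp (hf : IsAdmissibleCost p L P f) (hp : 1 < p)
    (hX : Measurable X) (hA : Measurable A) (hAL : ∀ ω, A ω ∈ cube T L)
    (h : Integrable (fun ω => ‖X ω‖ ^ p) ρ) : Integrable (fun ω => f (X ω) (A ω)) ρ := by
  obtain ⟨C, hC, hb⟩ := hf.exists_bound hp
  exact (((integrable_const (1 : ℝ)).add h).const_mul C).mono'
    (hf.measurable_comp hX hA).aestronglyMeasurable
    (Eventually.of_forall fun ω => hb _ _ (hAL ω))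

theorem IsAdmissibleCost.memLp_partialX (hf : IsAdmissibleCost p L P f)
    (hpq : p.HolderConjugate q) (hX : Measurable X) (hA : Measurable A)
    (hAL : ∀ ω, A ω ∈ cube T L) (h : Integrable (fun ω => ‖X ω‖ ^ p) ρ) (t : Fin T) :
    MemLp (fun ω => partialX f t (X ω) (A ω)) (ENNReal.ofReal q) ρ := by
  obtain ⟨C, hC, hb⟩ := hf.exists_growth hpq.lt
  have h1 : MemLp (fun ω => C * (1 + ‖X ω‖ ^ (p - 1))) (ENNReal.ofReal q) ρ :=
    ((memLp_const (1 : ℝ)).add (memLp_norm_rpow_sub_one hpq hX h)).const_mul C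
  refine h1.mono' (hf.measurable_partialX hX hA t).aestronglyMeasurable
    (Eventually.of_forall fun ω => ?_)
  exact (Finset.single_le_sum (f := fun t => |partialX f t (X ω) (A ω)|)
    (fun t _ => abs_nonneg _) (Finset.mem_univ t)).trans (hb _ _ (hAL ω))

end Integrability

end Cost

/-! ### The convexity gap and the optimal control -/

section Optimal

variable {T : ℕ} {p q L : ℝ} {P : Measure (Fin T → ℝ)} {f : (Fin T → ℝ) → (Fin T → ℝ) → ℝ}

/-- The midpoint of two control values. -/
def mid {T : ℕ} (a b : Fin T → ℝ) : Fin T → ℝ := (2⁻¹ : ℝ) • a + (2⁻¹ : ℝ) • b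

/-- The midpoint convexity gap of `f(x, ·)`. It measures the distance between two controls without
reference to the modulus of convexity `ε`, which need not be measurable. -/
def gap {T : ℕ} (f : (Fin T → ℝ) → (Fin T → ℝ) → ℝ) (x a b : Fin T → ℝ) : ℝ :=
  2⁻¹ * f x a + 2⁻¹ * f x b - f x (mid a b)

theorem mid_mem_cube {a b : Fin T → ℝ} (ha : a ∈ cube T L) (hb : b ∈ cube T L) :
    mid a b ∈ cube T L :=
  convex_cube T L ha hb (by norm_num) (by norm_num) (by norm_num)

theorem mid_mem_controls {a b : (Fin T → ℝ) → (Fin T → ℝ)} (ha : a ∈ controls T L)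
    (hb : b ∈ controls T L) : (fun x => mid (a x) (b x)) ∈ controls T L := by
  refine ⟨fun t => ?_, fun x => mid_mem_cube (ha.2 x) (hb.2 x)⟩
  exact ((ha.1 t).const_mul (2⁻¹ : ℝ)).add ((hb.1 t).const_mul (2⁻¹ : ℝ))

theorem gap_nonneg {x a b : Fin T → ℝ} (h : ConvexOn ℝ (cube T L) (f x)) (ha : a ∈ cube T L)
    (hb : b ∈ cube T L) : 0 ≤ gap f x a b := by
  have : f x (mid a b) ≤ (2⁻¹ : ℝ) • f x a + (2⁻¹ : ℝ) • f x b :=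
    h.2 ha hb (by norm_num) (by norm_num) (by norm_num)
  simpa [gap] using this

/-- A lower bound on the Hessian along a segment bounds the midpoint gap from below: subtracting the
corresponding parabola leaves a convex function. -/
theorem le_gap {x a b : Fin T → ℝ} (hC : ContDiff ℝ 2 (f x)) {ε : ℝ}
    (hε : ∀ c ∈ cube T L, ∀ z : Fin T → ℝ, ε * ∑ t, z t ^ 2 ≤ fderiv ℝ (fderiv ℝ (f x)) c z z)
    (ha : a ∈ cube T L) (hb : b ∈ cube T L) :
    ε / 8 * ∑ t, (a t - b t) ^ 2 ≤ gap f x a b := by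
  set m := ε * ∑ t, (b - a) t ^ 2 with hm
  set γ : ℝ → (Fin T → ℝ) := fun s => a + s • (b - a) with hγ
  have hγd : ∀ s, HasDerivAt γ (b - a) s := fun s =>
    (((hasDerivAt_id s).smul_const (b - a)).const_add a).congr_deriv (one_smul _ _)
  have hd1 : Differentiable ℝ (f x) := hC.differentiable (by norm_num)
  have hd2 : Differentiable ℝ (fderiv ℝ (f x)) :=
    (hC.fderiv_right (m := 1) (by norm_num)).differentiable (by norm_num)
  set φ : ℝ → ℝ := fun s => f x (γ s) - m * s ^ 2 / 2
  have hφ1 : ∀ s, HasDerivAt φ (fderiv ℝ (f x) (γ s) (b - a) - m * s) s := by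
    intro s
    have h1 := (hd1 (γ s)).hasFDerivAt.comp_hasDerivAt s (hγd s)
    have h2 := (((hasDerivAt_pow 2 s).const_mul m).div_const 2)
    refine (h1.sub h2).congr_deriv ?_
    push_cast
    ring
  have hφ2 : ∀ s, HasDerivAt (fun s => fderiv ℝ (f x) (γ s) (b - a) - m * s)
      (fderiv ℝ (fderiv ℝ (f x)) (γ s) (b - a) (b - a) - m) s := by
    intro s
    have h1 := ((hd2 (γ s)).hasFDerivAt.comp_hasDerivAt s (hγd s)).clm_apply
      (hasDerivAt_const s (b - a))
    have h2 := (hasDerivAt_id s).const_mul m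
    refine (h1.sub h2).congr_deriv ?_
    simp
  have hconv : ConvexOn ℝ (Set.Icc 0 1) φ := by
    refine convexOn_of_hasDerivWithinAt2_nonneg (convex_Icc 0 1)
      (fun s _ => (hφ1 s).continuousAt.continuousWithinAt)
      (fun s _ => (hφ1 s).hasDerivWithinAt) (fun s _ => (hφ2 s).hasDerivWithinAt) fun s hs => ?_
    rw [interior_Icc] at hs
    have hγs : γ s ∈ cube T L := by
      have := (convex_cube T L).add_smul_sub_mem ha hb ⟨hs.1.le, hs.2.le⟩
      exact this
    have := hε (γ s) hγs (b - a)
    linarith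
  have key : φ ((2⁻¹ : ℝ) • 0 + (2⁻¹ : ℝ) • 1) ≤ (2⁻¹ : ℝ) • φ 0 + (2⁻¹ : ℝ) • φ 1 :=
    hconv.2 (by simp) (by simp) (by norm_num) (by norm_num) (by norm_num)
  have h0 : γ 0 = a := by simp [hγ]
  have h1 : γ 1 = b := by simp [hγ]
  have h2 : γ (2⁻¹ : ℝ) = mid a b := by
    ext t; simp [hγ, mid]; ring
  simp only [φ, smul_eq_mul, mul_zero, zero_add, mul_one, h0, h1, h2] at key
  have hsum : m = ε * ∑ t, (a t - b t) ^ 2 := by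
    rw [hm]
    congr 1
    refine Finset.sum_congr rfl fun t _ => ?_
    simp only [Pi.sub_apply]; ring
  simp only [gap]
  rw [div_mul_eq_mul_div, ← hsum]
  norm_num at key
  linarith

theorem cost_image_nonempty (hL : 0 ≤ L) (Q : Measure (Fin T → ℝ)) :
    (cost f Q '' controls T L).Nonempty :=
  ⟨_, _, const_zero_mem_controls hL, rfl⟩

theorem IsAdmissibleCost.integrable_cost (hf : IsAdmissibleCost p L P f) (hp : 1 < p)
    {Q : Measure (Fin T → ℝ)} (hQ : IsModel T p Q) {a : (Fin T → ℝ) → (Fin T → ℝ)}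
    (ha : a ∈ controls T L) : Integrable (fun x => f x (a x)) Q := by
  have := hQ.1
  exact hf.integrable_comp hp measurable_id (measurable_of_mem_controls ha) ha.2
    (hQ.integrable_norm_rpow (by linarith))

theorem IsAdmissibleCost.exists_abs_cost_le (hf : IsAdmissibleCost p L P f) (hp : 1 < p) :
    ∃ C : ℝ, 0 ≤ C ∧ ∀ Q, IsModel T p Q → ∀ a ∈ controls T L,
      |cost f Q a| ≤ C * (1 + ∫ x, ‖x‖ ^ p ∂Q) := by
  obtain ⟨C, hC, hb⟩ := hf.exists_bound hp
  refine ⟨C, hC, fun Q hQ a ha => ?_⟩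
  have := hQ.1
  have hi := hQ.integrable_norm_rpow (by linarith)
  have h : C * (1 + ∫ x, ‖x‖ ^ p ∂Q) = ∫ x, C * (1 + ‖x‖ ^ p) ∂Q := by
    rw [integral_const_mul, integral_add (integrable_const _) hi]
    simp
  rw [h]
  refine norm_integral_le_of_norm_le (f := fun x => f x (a x)) (g := fun x => C * (1 + ‖x‖ ^ p))
    (((integrable_const _).add hi).const_mul C) (Eventually.of_forall fun x => hb x _ (ha.2 x))

theorem IsAdmissibleCost.bddBelow_cost (hf : IsAdmissibleCost p L P f) (hp : 1 < p)
    {Q : Measure (Fin T → ℝ)} (hQ : IsModel T p Q) : BddBelow (cost f Q '' controls T L) := by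
  obtain ⟨C, hC, hb⟩ := hf.exists_abs_cost_le hp
  refine ⟨-(C * (1 + ∫ x, ‖x‖ ^ p ∂Q)), ?_⟩
  rintro _ ⟨a, ha, rfl⟩
  exact (abs_le.1 (hb Q hQ a ha)).1

theorem IsAdmissibleCost.value_le_cost (hf : IsAdmissibleCost p L P f) (hp : 1 < p)
    {Q : Measure (Fin T → ℝ)} (hQ : IsModel T p Q) {a : (Fin T → ℝ) → (Fin T → ℝ)}
    (ha : a ∈ controls T L) : value L f Q ≤ cost f Q a :=
  csInf_le (hf.bddBelow_cost hp hQ) ⟨a, ha, rfl⟩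

theorem exists_cost_lt (hL : 0 ≤ L) (Q : Measure (Fin T → ℝ)) {δ : ℝ} (hδ : 0 < δ) :
    ∃ a ∈ controls T L, cost f Q a < value L f Q + δ := by
  obtain ⟨_, ⟨a, ha, rfl⟩, h⟩ := exists_lt_of_csInf_lt (cost_image_nonempty (f := f) hL Q)
    (lt_add_of_pos_right (value L f Q) hδ)
  exact ⟨a, ha, h⟩

theorem IsAdmissibleCost.integrable_gap (hf : IsAdmissibleCost p L P f) (hp : 1 < p)
    (hP : IsModel T p P) {a b : (Fin T → ℝ) → (Fin T → ℝ)} (ha : a ∈ controls T L)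
    (hb : b ∈ controls T L) : Integrable (fun x => gap f x (a x) (b x)) P :=
  (((hf.integrable_cost hp hP ha).const_mul _).add
    ((hf.integrable_cost hp hP hb).const_mul _)).sub
      (hf.integrable_cost hp hP (mid_mem_controls ha hb))

/-- Two nearly optimal controls have a small expected gap, because their midpoint is a control. -/
theorem IsAdmissibleCost.integral_gap_le (hf : IsAdmissibleCost p L P f) (hp : 1 < p)
    (hP : IsModel T p P) {a b : (Fin T → ℝ) → (Fin T → ℝ)} (ha : a ∈ controls T L)
    (hb : b ∈ controls T L) :
    ∫ x, gap f x (a x) (b x) ∂P ≤ 2⁻¹ * cost f P a + 2⁻¹ * cost f P b - value L f P := by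
  have h1 := hf.integrable_cost hp hP ha
  have h2 := hf.integrable_cost hp hP hb
  have h3 := hf.integrable_cost hp hP (mid_mem_controls ha hb)
  have h4 := hf.value_le_cost hp hP (mid_mem_controls ha hb)
  have : ∫ x, gap f x (a x) (b x) ∂P
      = 2⁻¹ * cost f P a + 2⁻¹ * cost f P b - cost f P (fun x => mid (a x) (b x)) := by
    simp only [gap, cost]
    have h12 : Integrable (fun x => 2⁻¹ * f x (a x) + 2⁻¹ * f x (b x)) P :=
      (h1.const_mul _).add (h2.const_mul _)
    rw [integral_sub h12 h3,
      integral_add (h1.const_mul _) (h2.const_mul _), integral_const_mul, integral_const_mul]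
  linarith

/-- Almost surely, the gap of `f(x, ·)` dominates the squared distance. -/
theorem IsAdmissibleCost.ae_le_gap (hf : IsAdmissibleCost p L P f) :
    ∀ᵐ x ∂P, ∃ C : ℝ, 0 < C ∧ ∀ a ∈ cube T L, ∀ b ∈ cube T L,
      ∀ t, (a t - b t) ^ 2 ≤ C * gap f x a b := by
  obtain ⟨ε, hε, hs⟩ := hf.strong
  filter_upwards [hε, hs] with x hx hsx
  refine ⟨8 / ε x, by positivity, fun a ha b hb t => ?_⟩
  have h1 := le_gap (hf.contDiff x) hsx ha hb
  have h2 : (a t - b t) ^ 2 ≤ ∑ t, (a t - b t) ^ 2 :=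
    Finset.single_le_sum (f := fun t => (a t - b t) ^ 2) (fun t _ => sq_nonneg _)
      (Finset.mem_univ t)
  refine h2.trans ?_
  rw [div_mul_eq_mul_div, le_div_iff₀ hx]
  linarith

/-- Controls whose cost converges fast to the optimal value converge almost surely. -/
theorem IsAdmissibleCost.ae_cauchySeq (hf : IsAdmissibleCost p L P f) (hp : 1 < p)
    (hP : IsModel T p P) {a : ℕ → (Fin T → ℝ) → (Fin T → ℝ)} (ha : ∀ n, a n ∈ controls T L)
    (hc : ∀ n, cost f P (a n) < value L f P + (1 / 8) ^ n) :
    ∀ᵐ x ∂P, ∀ t, CauchySeq fun n => a n x t := by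
  have hgi := fun n => hf.integrable_gap hp hP (ha n) (ha (n + 1))
  have hg0 : ∀ n x, 0 ≤ gap f x (a n x) (a (n + 1) x) := fun n x =>
    gap_nonneg (hf.convex x) ((ha n).2 x) ((ha (n + 1)).2 x)
  -- The weights `4 ^ n` still give summable expectations, and their size turns the almost sure
  -- finiteness of the sum into a geometric bound on the gaps.
  set F : ℕ → (Fin T → ℝ) → ℝ := fun n x => 4 ^ n * gap f x (a n x) (a (n + 1) x)
  have hF0 : ∀ n x, 0 ≤ F n x := fun n x => mul_nonneg (by positivity) (hg0 n x)
  have hFm : ∀ n, Measurable (F n) := fun n => by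
    have h1 := hf.measurable_comp measurable_id (measurable_of_mem_controls (ha n))
    have h2 := hf.measurable_comp measurable_id (measurable_of_mem_controls (ha (n + 1)))
    have h3 := hf.measurable_comp measurable_id
      (measurable_of_mem_controls (mid_mem_controls (ha n) (ha (n + 1))))
    exact (((h1.const_mul _).add (h2.const_mul _)).sub h3).const_mul _
  have hFint : ∀ n, ∫ x, F n x ∂P ≤ (1 / 2) ^ n := by
    intro n
    have h1 := hf.integral_gap_le hp hP (ha n) (ha (n + 1))
    have h2 := hc n
    have h3 := hc (n + 1)
    have h4 : (1 / 8 : ℝ) ^ (n + 1) ≤ (1 / 8) ^ n :=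
      pow_le_pow_of_le_one (by norm_num) (by norm_num) (Nat.le_succ n)
    rw [integral_const_mul]
    calc (4 : ℝ) ^ n * ∫ x, gap f x (a n x) (a (n + 1) x) ∂P ≤ 4 ^ n * (1 / 8) ^ n :=
          mul_le_mul_of_nonneg_left (by linarith) (by positivity)
      _ = (1 / 2) ^ n := by rw [← mul_pow]; norm_num
  have hlint : ∫⁻ x, ∑' n, ENNReal.ofReal (F n x) ∂P ≠ ∞ := by
    rw [lintegral_tsum fun n => (hFm n).ennreal_ofReal.aemeasurable]
    have hle : ∑' n, ∫⁻ x, ENNReal.ofReal (F n x) ∂P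
        ≤ ∑' n : ℕ, ENNReal.ofReal ((1 / 2) ^ n) := by
      refine ENNReal.tsum_le_tsum fun n => ?_
      rw [← ofReal_integral_eq_lintegral_ofReal ((hgi n).const_mul _)
        (Eventually.of_forall (hF0 n))]
      exact ENNReal.ofReal_le_ofReal (hFint n)
    refine ne_top_of_le_ne_top ?_ hle
    rw [← ENNReal.ofReal_tsum_of_nonneg (fun n => by positivity) summable_geometric_two]
    exact ENNReal.ofReal_ne_top
  have hfin := ae_lt_top (Measurable.tsum fun n => (hFm n).ennreal_ofReal) hlint
  filter_upwards [hfin, hf.ae_le_gap] with x hx ⟨C, hC, hle⟩ t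
  set S := (∑' n, ENNReal.ofReal (F n x)).toReal
  have hFS : ∀ n, F n x ≤ S := fun n => by
    rw [← ENNReal.toReal_ofReal (hF0 n x)]
    exact ENNReal.toReal_mono hx.ne (ENNReal.le_tsum n)
  have hS0 : 0 ≤ S := ENNReal.toReal_nonneg
  refine cauchySeq_of_le_geometric (1 / 2) (Real.sqrt (C * S)) (by norm_num) fun n => ?_
  rw [Real.dist_eq]
  refine abs_le_of_sq_le_sq ?_ (by positivity)
  rw [mul_pow, Real.sq_sqrt (by positivity), ← pow_mul, mul_comm n 2, pow_mul]
  refine (hle _ ((ha n).2 x) _ ((ha (n + 1)).2 x) t).trans ?_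
  rw [mul_assoc]
  refine mul_le_mul_of_nonneg_left ?_ hC.le
  have h4 : (4 : ℝ) ^ n * ((1 / 2) ^ 2) ^ n = 1 := by rw [← mul_pow]; norm_num
  calc gap f x (a n x) (a (n + 1) x)
      = ((4 : ℝ) ^ n * ((1 / 2) ^ 2) ^ n) * gap f x (a n x) (a (n + 1) x) := by rw [h4, one_mul]
    _ = F n x * ((1 / 2) ^ 2) ^ n := by simp only [F]; ring
    _ ≤ S * ((1 / 2) ^ 2) ^ n := mul_le_mul_of_nonneg_right (hFS n) (by positivity)

theorem IsAdmissibleCost.exists_optimal (hf : IsAdmissibleCost p L P f) (hp : 1 < p) (hL : 0 ≤ L)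
    (hP : IsModel T p P) : ∃ a ∈ controls T L, value L f P = cost f P a := by
  have := hP.1
  choose a ha hc using fun n : ℕ =>
    exists_cost_lt (f := f) hL P (by positivity : (0 : ℝ) < (1 / 8) ^ n)
  -- The limit exists only almost surely; clamping keeps the junk values of `limUnder` in the cube.
  set b : (Fin T → ℝ) → (Fin T → ℝ) := fun x t =>
    max (-L) (min L (limUnder atTop fun n => a n x t)) with hb
  have hbc : b ∈ controls T L := by
    refine ⟨fun t => ?_, fun x t => ?_⟩
    · have h : Measurable[pathSigma T t] fun x => limUnder atTop fun n => a n x t :=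
        (@StronglyMeasurable.limUnder _ _ _ (pathSigma T t) _ _ _ _ _ _ _
          fun n => ((ha n).1 t).stronglyMeasurable).measurable
      exact (by fun_prop : Measurable fun u : ℝ => max (-L) (min L u)).comp h
    · exact abs_le.2 ⟨le_max_left _ _, max_le (by linarith) (min_le_left _ _)⟩
  have hlim : ∀ᵐ x ∂P, Tendsto (fun n => a n x) atTop (𝓝 (b x)) := by
    filter_upwards [hf.ae_cauchySeq hp hP ha hc] with x hx
    refine tendsto_pi_nhds.2 fun t => ?_
    have h1 := (hx t).tendsto_limUnder
    have hmem : limUnder atTop (fun n => a n x t) ∈ Set.Icc (-L) L :=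
      isClosed_Icc.mem_of_tendsto h1 (Eventually.of_forall fun n => abs_le.1 ((ha n).2 x t))
    have : b x t = limUnder atTop fun n => a n x t :=
      (congrArg (max (-L)) (min_eq_right hmem.2)).trans (max_eq_right hmem.1)
    rwa [this]
  refine ⟨b, hbc, ?_⟩
  obtain ⟨C, hC, hbd⟩ := hf.exists_bound hp
  have h1 : Tendsto (fun n => cost f P (a n)) atTop (𝓝 (cost f P b)) := by
    refine tendsto_integral_of_dominated_convergence (fun x => C * (1 + ‖x‖ ^ p))
      (fun n => (hf.integrable_cost hp hP (ha n)).aestronglyMeasurable)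
      (((integrable_const _).add (hP.integrable_norm_rpow (by linarith))).const_mul C)
      (fun n => Eventually.of_forall fun x => hbd x _ ((ha n).2 x)) ?_
    filter_upwards [hlim] with x hx
    exact ((hf.contDiff x).continuous.tendsto _).comp hx
  have h2 : Tendsto (fun n : ℕ => value L f P + (1 / 8 : ℝ) ^ n) atTop (𝓝 (value L f P + 0)) :=
    tendsto_const_nhds.add (tendsto_pow_atTop_nhds_zero_of_lt_one (by norm_num) (by norm_num))
  rw [add_zero] at h2
  exact le_antisymm (hf.value_le_cost hp hP hbc)
    (le_of_tendsto_of_tendsto' h1 h2 fun n => (hc n).le)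

/-- A minimizing sequence of controls converges almost surely to a given optimal control, along a
subsequence. -/
theorem IsAdmissibleCost.exists_subseq_tendsto (hf : IsAdmissibleCost p L P f) (hp : 1 < p)
    (hP : IsModel T p P) {a : (Fin T → ℝ) → (Fin T → ℝ)} (ha : a ∈ controls T L)
    (hopt : value L f P = cost f P a) {b : ℕ → (Fin T → ℝ) → (Fin T → ℝ)}
    (hb : ∀ n, b n ∈ controls T L)
    (hlim : Tendsto (fun n => cost f P (b n)) atTop (𝓝 (value L f P))) :
    ∃ ns : ℕ → ℕ, StrictMono ns ∧ ∀ᵐ x ∂P, Tendsto (fun k => b (ns k) x) atTop (𝓝 (a x)) := by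
  have hgi := fun n => hf.integrable_gap hp hP (hb n) ha
  have hg0 : ∀ n x, 0 ≤ gap f x (b n x) (a x) := fun n x =>
    gap_nonneg (hf.convex x) ((hb n).2 x) (ha.2 x)
  have hint : Tendsto (fun n => ∫ x, gap f x (b n x) (a x) ∂P) atTop (𝓝 0) := by
    refine squeeze_zero (fun n => integral_nonneg (hg0 n))
      (fun n => hf.integral_gap_le hp hP (hb n) ha) ?_
    have := ((hlim.const_mul 2⁻¹).add_const (2⁻¹ * cost f P a)).sub_const (value L f P)
    rw [← hopt] at this ⊢
    convert this using 2
    ring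
  have hmeas : TendstoInMeasure P (fun n x => gap f x (b n x) (a x)) atTop fun _ => (0 : ℝ) := by
    refine tendstoInMeasure_of_tendsto_eLpNorm one_ne_zero (fun n => (hgi n).aestronglyMeasurable)
      aestronglyMeasurable_const ?_
    have : ∀ n, eLpNorm ((fun x => gap f x (b n x) (a x)) - fun _ => (0 : ℝ)) 1 P
        = ENNReal.ofReal (∫ x, gap f x (b n x) (a x) ∂P) := by
      intro n
      rw [eLpNorm_one_eq_lintegral_enorm, ofReal_integral_eq_lintegral_ofReal (hgi n)
        (Eventually.of_forall (hg0 n))]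
      refine lintegral_congr fun x => ?_
      simp [Real.enorm_eq_ofReal (hg0 n x)]
    simp_rw [this]
    simpa using ENNReal.tendsto_ofReal hint
  obtain ⟨ns, hns, hae⟩ := hmeas.exists_seq_tendsto_ae
  refine ⟨ns, hns, ?_⟩
  filter_upwards [hae, hf.ae_le_gap] with x hx ⟨C, hC, hle⟩
  refine tendsto_pi_nhds.2 fun t => ?_
  have h1 : Tendsto (fun k => (b (ns k) x t - a x t) ^ 2) atTop (𝓝 0) := by
    refine squeeze_zero (fun k => sq_nonneg _)
      (fun k => hle _ ((hb (ns k)).2 x) _ (ha.2 x) t) ?_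
    simpa using hx.const_mul C
  have h2 : Tendsto (fun k => |b (ns k) x t - a x t|) atTop (𝓝 0) := by
    have := (Real.continuous_sqrt.tendsto 0).comp h1
    simpa [Function.comp_def, Real.sqrt_sq_eq_abs] using this
  exact tendsto_iff_norm_sub_tendsto_zero.2 h2

theorem IsAdmissibleCost.optimal_unique (hf : IsAdmissibleCost p L P f) (hp : 1 < p)
    (hP : IsModel T p P) {a b : (Fin T → ℝ) → (Fin T → ℝ)} (ha : a ∈ controls T L)
    (hopt : value L f P = cost f P a) (hb : b ∈ controls T L)
    (hopt' : value L f P = cost f P b) : b =ᵐ[P] a := by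
  obtain ⟨ns, -, h⟩ := hf.exists_subseq_tendsto hp hP ha hopt (b := fun _ => b) (fun _ => hb)
    (by rw [hopt']; exact tendsto_const_nhds)
  filter_upwards [h] with x hx
  exact tendsto_nhds_unique tendsto_const_nhds hx

end Optimal

/-! ### Uniform linearization of the cost -/

section Remainder

variable {T : ℕ} {p q L : ℝ} {P : Measure (Fin T → ℝ)} {f : (Fin T → ℝ) → (Fin T → ℝ) → ℝ}

/-- The remainder of the first-order expansion of `f(·, a)` at `x` in the direction `h`. -/
def remainder {T : ℕ} (f : (Fin T → ℝ) → (Fin T → ℝ) → ℝ) (a x h : Fin T → ℝ) : ℝ :=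
  f (x + h) a - f x a - ∑ t, partialX f t x a * h t

theorem IsAdmissibleCost.exists_remainder_bound (hf : IsAdmissibleCost p L P f) (hp : 1 < p) :
    ∃ C : ℝ, 0 ≤ C ∧ ∀ a ∈ cube T L, ∀ x h,
      |remainder f a x h| ≤ C * (1 + ‖x‖ ^ (p - 1)) * ‖h‖ + C * ‖h‖ ^ p := by
  obtain ⟨C, hC, hgr, hinc⟩ := hf.exists_increment hp
  refine ⟨2 * C, by positivity, fun a ha x h => ?_⟩
  have h1 := hinc x h a ha
  have h2 : |∑ t, partialX f t x a * h t| ≤ C * (1 + ‖x‖ ^ (p - 1)) * ‖h‖ := by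
    rw [← fderiv_apply_eq_sum]
    refine ((fderiv ℝ (fun y => f y a) x).le_opNorm h).trans ?_
    exact mul_le_mul_of_nonneg_right ((norm_fderiv_le_sum f x a).trans (hgr x a ha))
      (norm_nonneg _)
  have h3 : ‖h‖ ^ (p - 1) * ‖h‖ = ‖h‖ ^ p := by
    rw [← Real.rpow_add_one' (norm_nonneg h) (by linarith), sub_add_cancel]
  have h4 : |remainder f a x h| ≤ |f (x + h) a - f x a| + |∑ t, partialX f t x a * h t| :=
    abs_sub _ _
  have h5 : 0 ≤ C * ‖h‖ ^ p := by positivity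
  have h6 : C * (1 + ‖x‖ ^ (p - 1) + ‖h‖ ^ (p - 1)) * ‖h‖
      = C * (1 + ‖x‖ ^ (p - 1)) * ‖h‖ + C * ‖h‖ ^ p := by rw [← h3]; ring
  nlinarith

theorem IsAdmissibleCost.continuous_remainder (hf : IsAdmissibleCost p L P f) (a x : Fin T → ℝ) :
    Continuous (remainder f a x) := by
  have := (hf.differentiable a).continuous
  unfold remainder
  fun_prop

theorem IsAdmissibleCost.exists_remainder_le_of_norm_lt (hf : IsAdmissibleCost p L P f) (a x : Fin T → ℝ)
    {η : ℝ} (hη : 0 < η) : ∃ δ > 0, ∀ h, ‖h‖ < δ → |remainder f a x h| ≤ η * ‖h‖ := by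
  have h1 := (hf.differentiable a x).hasFDerivAt.isLittleO
  obtain ⟨δ, hδ, hb⟩ := Metric.eventually_nhds_iff.1 (h1.def hη)
  refine ⟨δ, hδ, fun h hh => ?_⟩
  have := hb (y := x + h) (by simpa using hh)
  simpa [remainder, fderiv_apply_eq_sum] using this

/-- The excess of the remainder over `n ‖h‖ ^ p`, relative to `‖h‖` and maximized over the
increments `h`. The supremum runs over a dense sequence, which makes it measurable. -/
def excess {T : ℕ} (p : ℝ) (f : (Fin T → ℝ) → (Fin T → ℝ) → ℝ) (n : ℕ) (a x : Fin T → ℝ) : ℝ≥0∞ :=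
  ⨆ i : ℕ, ENNReal.ofReal ((|remainder f a x (TopologicalSpace.denseSeq (Fin T → ℝ) i)|
    - n * ‖TopologicalSpace.denseSeq (Fin T → ℝ) i‖ ^ p) /
      ‖TopologicalSpace.denseSeq (Fin T → ℝ) i‖)

theorem excess_le {n : ℕ} {a x : Fin T → ℝ} {M : ℝ} (hM : 0 ≤ M)
    (h : ∀ h, |remainder f a x h| ≤ M * ‖h‖ + n * ‖h‖ ^ p) :
    excess p f n a x ≤ ENNReal.ofReal M :=
  iSup_le fun i => ENNReal.ofReal_le_ofReal
    (div_le_of_le_mul₀ (norm_nonneg _) hM (by linarith [h (TopologicalSpace.denseSeq (Fin T → ℝ) i)]))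

theorem IsAdmissibleCost.remainder_le_excess (hf : IsAdmissibleCost p L P f) (hp : 1 < p) {n : ℕ}
    {a x : Fin T → ℝ} (hfin : excess p f n a x ≠ ∞) (h : Fin T → ℝ) :
    |remainder f a x h| ≤ (excess p f n a x).toReal * ‖h‖ + n * ‖h‖ ^ p := by
  have hcl : IsClosed {h : Fin T → ℝ |
      |remainder f a x h| ≤ (excess p f n a x).toReal * ‖h‖ + n * ‖h‖ ^ p} := by
    refine isClosed_le (hf.continuous_remainder a x).abs ?_
    have : Continuous fun h : Fin T → ℝ => ‖h‖ ^ p :=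
      continuous_norm.rpow_const fun _ => Or.inr (by linarith)
    fun_prop
  refine (TopologicalSpace.denseRange_denseSeq (Fin T → ℝ)).induction_on
    (p := fun h => |remainder f a x h| ≤ (excess p f n a x).toReal * ‖h‖ + n * ‖h‖ ^ p)
    h hcl fun i => ?_
  set d := TopologicalSpace.denseSeq (Fin T → ℝ) i
  rcases eq_or_ne d 0 with hd | hd
  · simp [hd, remainder, Real.zero_rpow (by linarith : p ≠ 0)]
  · have h1 : (|remainder f a x d| - n * ‖d‖ ^ p) / ‖d‖ ≤ (excess p f n a x).toReal :=
      (ENNReal.ofReal_le_iff_le_toReal hfin).1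
        (le_iSup (fun i : ℕ => ENNReal.ofReal ((|remainder f a x
          (TopologicalSpace.denseSeq (Fin T → ℝ) i)|
          - n * ‖TopologicalSpace.denseSeq (Fin T → ℝ) i‖ ^ p) /
            ‖TopologicalSpace.denseSeq (Fin T → ℝ) i‖)) i)
    rw [div_le_iff₀ (norm_pos_iff.2 hd)] at h1
    linarith

theorem IsAdmissibleCost.measurable_excess (hf : IsAdmissibleCost p L P f) (n : ℕ)
    {a : (Fin T → ℝ) → (Fin T → ℝ)} (ha : Measurable a) :
    Measurable fun x => excess p f n (a x) x := by
  refine Measurable.iSup fun i => ?_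
  have h1 : Measurable fun x => remainder f (a x) x (TopologicalSpace.denseSeq (Fin T → ℝ) i) := by
    unfold remainder
    refine ((hf.measurable_comp (measurable_id.add_const _) ha).sub
      (hf.measurable_comp measurable_id ha)).sub ?_
    exact Finset.measurable_sum _ fun t _ => (hf.measurable_partialX measurable_id ha t).mul_const _
  exact (((h1.abs).sub_const _).div_const _).ennreal_ofReal

/-- Pointwise, the excess vanishes as `n → ∞`: small increments have a small relative remainder by
differentiability, and larger ones are absorbed by `n ‖h‖ ^ p`. -/
theorem IsAdmissibleCost.tendsto_excess (hf : IsAdmissibleCost p L P f) (hp : 1 < p)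
    {a x : Fin T → ℝ} (ha : a ∈ cube T L) :
    Tendsto (fun n => (excess p f n a x).toReal) atTop (𝓝 0) := by
  obtain ⟨C, hC, hb⟩ := hf.exists_remainder_bound hp
  refine Metric.tendsto_atTop.2 fun η hη => ?_
  obtain ⟨δ, hδ, hsmall⟩ := hf.exists_remainder_le_of_norm_lt a x (half_pos hη)
  have hδp : 0 < δ ^ (p - 1) := by positivity
  obtain ⟨N, hN⟩ := exists_nat_ge (C + C * (1 + ‖x‖ ^ (p - 1)) / δ ^ (p - 1))
  refine ⟨N, fun n hn => ?_⟩
  have hle : excess p f n a x ≤ ENNReal.ofReal (η / 2) := by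
    refine excess_le (half_pos hη).le fun h => ?_
    rcases lt_or_ge ‖h‖ δ with hh | hh
    · have h1 := hsmall h hh
      have h2 : 0 ≤ (n : ℝ) * ‖h‖ ^ p := by positivity
      linarith
    · have h1 := hb a ha x h
      have h2 : ‖h‖ ^ (p - 1) * ‖h‖ = ‖h‖ ^ p := by
        rw [← Real.rpow_add_one' (norm_nonneg h) (by linarith), sub_add_cancel]
      have h3 : δ ^ (p - 1) ≤ ‖h‖ ^ (p - 1) := Real.rpow_le_rpow hδ.le hh (by linarith)
      have h4 : C * (1 + ‖x‖ ^ (p - 1)) / δ ^ (p - 1) ≤ n - C := by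
        have : (N : ℝ) ≤ n := by exact_mod_cast hn
        linarith
      have h5 : C * (1 + ‖x‖ ^ (p - 1)) ≤ (n - C) * ‖h‖ ^ (p - 1) := by
        have h6 : 0 ≤ (n : ℝ) - C := le_trans (by positivity) h4
        rw [div_le_iff₀ hδp] at h4
        exact h4.trans (mul_le_mul_of_nonneg_left h3 h6)
      have h7 : C * (1 + ‖x‖ ^ (p - 1)) * ‖h‖ ≤ (n - C) * ‖h‖ ^ p := by
        rw [← h2, ← mul_assoc]
        exact mul_le_mul_of_nonneg_right h5 (norm_nonneg h)
      have h8 : 0 ≤ η / 2 * ‖h‖ := by positivity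
      linarith
  have h0 := ENNReal.toReal_mono ENNReal.ofReal_ne_top hle
  rw [ENNReal.toReal_ofReal (half_pos hη).le] at h0
  rw [Real.dist_eq, sub_zero, abs_of_nonneg ENNReal.toReal_nonneg]
  linarith

/-- The remainder of the first-order expansion is at most `A(x) ‖h‖ + K ‖h‖ ^ p` with `A` as small
in `L^q(P)` as desired. Since `p > 1`, this makes the expected remainder `o(r)`, uniformly over all
couplings of cost at most `r`. -/
theorem IsAdmissibleCost.exists_remainder_le (hf : IsAdmissibleCost p L P f)
    (hpq : p.HolderConjugate q) (hP : IsModel T p P) {a : (Fin T → ℝ) → (Fin T → ℝ)}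
    (ha : a ∈ controls T L) {η : ℝ} (hη : 0 < η) :
    ∃ K : ℝ, 0 ≤ K ∧ ∃ A : (Fin T → ℝ) → ℝ, Measurable A ∧ (∀ x, 0 ≤ A x) ∧
      MemLp A (ENNReal.ofReal q) P ∧ (∫ x, A x ^ q ∂P) ^ (1 / q) ≤ η ∧
      ∀ x h, |remainder f (a x) x h| ≤ A x * ‖h‖ + K * ‖h‖ ^ p := by
  have := hP.1
  have hp := hpq.lt
  have hq0 : 0 < q := hpq.symm.pos
  obtain ⟨C, hC, hb⟩ := hf.exists_remainder_bound hp
  have hi := hP.integrable_norm_rpow hpq.pos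
  set D : (Fin T → ℝ) → ℝ := fun x => C * (1 + ‖x‖ ^ (p - 1))
  have hD0 : ∀ x, 0 ≤ D x := fun x => by positivity
  have hD : MemLp D (ENNReal.ofReal q) P :=
    ((memLp_const (1 : ℝ)).add (memLp_norm_rpow_sub_one hpq measurable_id hi)).const_mul C
  set A : ℕ → (Fin T → ℝ) → ℝ := fun n x => (excess p f n (a x) x).toReal
  have hAm : ∀ n, Measurable (A n) := fun n =>
    (hf.measurable_excess n (measurable_of_mem_controls ha)).ennreal_toReal
  have hA0 : ∀ n x, 0 ≤ A n x := fun n x => ENNReal.toReal_nonneg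
  have hbd : ∀ n : ℕ, C ≤ n → ∀ x, excess p f n (a x) x ≤ ENNReal.ofReal (D x) := by
    intro n hn x
    refine excess_le (hD0 x) fun h => (hb _ (ha.2 x) x h).trans ?_
    have := mul_le_mul_of_nonneg_right hn (by positivity : 0 ≤ ‖h‖ ^ p)
    linarith
  have hAD : ∀ n : ℕ, C ≤ n → ∀ x, A n x ≤ D x := by
    intro n hn x
    have := ENNReal.toReal_mono ENNReal.ofReal_ne_top (hbd n hn x)
    rwa [ENNReal.toReal_ofReal (hD0 x)] at this
  obtain ⟨N, hN⟩ := exists_nat_ge C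
  have hDq : Integrable (fun x => D x ^ q) P := by
    have := hD.integrable_norm_rpow (by simpa using hq0) ENNReal.ofReal_ne_top
    rw [ENNReal.toReal_ofReal hq0.le] at this
    exact this.congr (Eventually.of_forall fun x => by simp only [Real.norm_of_nonneg (hD0 x)])
  have hlim : Tendsto (fun n => (∫ x, A (n + N) x ^ q ∂P) ^ (1 / q)) atTop (𝓝 0) := by
    have h1 : Tendsto (fun n => ∫ x, A (n + N) x ^ q ∂P) atTop (𝓝 (∫ _, (0 : ℝ) ∂P)) := by
      refine tendsto_integral_of_dominated_convergence (fun x => D x ^ q)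
        (fun n => ((hAm _).pow_const q).aestronglyMeasurable) hDq (fun n => ?_) ?_
      · refine Eventually.of_forall fun x => ?_
        rw [Real.norm_of_nonneg (Real.rpow_nonneg (hA0 _ x) _)]
        refine Real.rpow_le_rpow (hA0 _ x) (hAD _ ?_ x) hq0.le
        push_cast
        linarith [(Nat.cast_nonneg n : (0 : ℝ) ≤ n)]
      · refine Eventually.of_forall fun x => ?_
        have h2 := ((hf.tendsto_excess hp (x := x) (ha.2 x)).comp
          (tendsto_add_atTop_nat N)).rpow_const (p := q) (Or.inr hq0.le)
        rwa [Real.zero_rpow hq0.ne'] at h2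
    rw [integral_zero] at h1
    have h3 := h1.rpow_const (p := 1 / q) (Or.inr (by positivity))
    rwa [Real.zero_rpow (by positivity)] at h3
  obtain ⟨n, hn⟩ := (hlim.eventually (ge_mem_nhds hη)).exists
  have hnC : C ≤ ((n + N : ℕ) : ℝ) := by
    push_cast
    linarith [(Nat.cast_nonneg n : (0 : ℝ) ≤ n)]
  refine ⟨(n + N : ℕ), Nat.cast_nonneg _, A (n + N), hAm _, hA0 _, ?_, hn, fun x h => ?_⟩
  · exact hD.mono' (hAm _).aestronglyMeasurable (Eventually.of_forall fun x => by
      rw [Real.norm_of_nonneg (hA0 _ x)]; exact hAD _ hnC x)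
  · exact hf.remainder_le_excess hp (ne_top_of_le_ne_top ENNReal.ofReal_ne_top (hbd _ hnC x)) h

end Remainder

/-! ### The upper bound -/

section Upper

variable {T : ℕ} {p q L : ℝ} {P Q : Measure (Fin T → ℝ)}
  {f : (Fin T → ℝ) → (Fin T → ℝ) → ℝ}

/-- The first-order coefficient of the robust value: the norm of the conditional partial derivatives
`E_P[∂_{x_t} f(X, a(X)) | F_t]` that is dual to the transport cost. -/
def slope {T : ℕ} (q : ℝ) (f : (Fin T → ℝ) → (Fin T → ℝ) → ℝ) (P : Measure (Fin T → ℝ))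
    (a : (Fin T → ℝ) → (Fin T → ℝ)) : ℝ :=
  (∑ t : Fin T, ∫ x, |condPartial f P a t x| ^ q ∂P) ^ (1 / q)

theorem slope_nonneg (a : (Fin T → ℝ) → (Fin T → ℝ)) : 0 ≤ slope q f P a :=
  Real.rpow_nonneg (Finset.sum_nonneg fun _ _ => integral_nonneg fun _ => by positivity) _

theorem integrable_abs_rpow_of_memLp {Ω : Type*} [MeasurableSpace Ω] {ρ : Measure Ω} {g : Ω → ℝ}
    {s : ℝ} (hs : 0 < s) (hg : MemLp g (ENNReal.ofReal s) ρ) :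
    Integrable (fun ω => |g ω| ^ s) ρ := by
  have := hg.integrable_norm_rpow (by simpa using hs) ENNReal.ofReal_ne_top
  rwa [ENNReal.toReal_ofReal hs.le] at this

theorem IsAdmissibleCost.memLp_partialX_control (hf : IsAdmissibleCost p L P f)
    (hpq : p.HolderConjugate q) (hP : IsModel T p P) {a : (Fin T → ℝ) → (Fin T → ℝ)}
    (ha : a ∈ controls T L) (t : Fin T) :
    MemLp (fun x => partialX f t x (a x)) (ENNReal.ofReal q) P := by
  have := hP.1
  exact hf.memLp_partialX hpq measurable_id (measurable_of_mem_controls ha) ha.2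
    (hP.integrable_norm_rpow hpq.pos) t

theorem one_le_ofReal_of_holderConjugate (hpq : p.HolderConjugate q) : 1 ≤ ENNReal.ofReal q := by
  simpa using ENNReal.ofReal_le_ofReal hpq.symm.lt.le

theorem IsAdmissibleCost.integrable_partialX_control (hf : IsAdmissibleCost p L P f)
    (hpq : p.HolderConjugate q) (hP : IsModel T p P) {a : (Fin T → ℝ) → (Fin T → ℝ)}
    (ha : a ∈ controls T L) (t : Fin T) : Integrable (fun x => partialX f t x (a x)) P := by
  have := hP.1
  exact (hf.memLp_partialX_control hpq hP ha t).integrable (one_le_ofReal_of_holderConjugate hpq)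

theorem IsAdmissibleCost.memLp_condPartial (hf : IsAdmissibleCost p L P f)
    (hpq : p.HolderConjugate q) (hP : IsModel T p P) {a : (Fin T → ℝ) → (Fin T → ℝ)}
    (ha : a ∈ controls T L) (t : Fin T) : MemLp (condPartial f P a t) (ENNReal.ofReal q) P :=
  (hf.memLp_partialX_control hpq hP ha t).condExp (one_le_ofReal_of_holderConjugate hpq)

theorem memLp_coord (hpq : p.HolderConjugate q) (hP : IsModel T p P) (t : Fin T) :
    MemLp (fun x : Fin T → ℝ => x t) (ENNReal.ofReal p) P :=
  (memLp_of_integrable_norm_rpow hpq.lt measurable_id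
    (hP.integrable_norm_rpow hpq.pos)).mono (measurable_pi_apply t).aestronglyMeasurable
      (Eventually.of_forall fun x => norm_le_pi_norm x t)

/-- A coupling that nearly attains the adapted distance, in terms of Bochner integrals. -/
theorem exists_coupling_of_adaptedW_le (hp : 0 < p) {r r' : ℝ} (hr : 0 ≤ r) (hrr' : r < r')
    (h : adaptedW p P Q ≤ ENNReal.ofReal r) :
    ∃ π : Measure ((Fin T → ℝ) × (Fin T → ℝ)), IsCoupling π P Q ∧ IsBicausal π ∧
      (∀ t, Integrable (fun z => |z.1 t - z.2 t| ^ p) π) ∧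
      ∑ t, ∫ z, |z.1 t - z.2 t| ^ p ∂π ≤ r' ^ p := by
  have hr' : 0 < r' := hr.trans_lt hrr'
  have hlt : adaptedW p P Q < ENNReal.ofReal r' :=
    h.trans_lt ((ENNReal.ofReal_lt_ofReal_iff hr').2 hrr')
  simp only [adaptedW, iInf_lt_iff] at hlt
  obtain ⟨π, ⟨hc, hb⟩, hπ⟩ := hlt
  have hS : ∑ t, ∫⁻ z, ENNReal.ofReal (|z.1 t - z.2 t| ^ p) ∂π < ENNReal.ofReal (r' ^ p) := by
    rw [one_div, ENNReal.rpow_inv_lt_iff hp, ENNReal.ofReal_rpow_of_pos hr'] at hπ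
    exact hπ
  have hfin : ∀ t : Fin T, ∫⁻ z, ENNReal.ofReal (|z.1 t - z.2 t| ^ p) ∂π < ∞ := fun t =>
    (Finset.single_le_sum (f := fun t => ∫⁻ z : (Fin T → ℝ) × (Fin T → ℝ),
      ENNReal.ofReal (|z.1 t - z.2 t| ^ p) ∂π) (fun _ _ => zero_le) (Finset.mem_univ t)).trans_lt
        (hS.trans ENNReal.ofReal_lt_top)
  have hmeas : ∀ t : Fin T, Measurable fun z : (Fin T → ℝ) × (Fin T → ℝ) => |z.1 t - z.2 t| ^ p :=
    fun t => by fun_prop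
  have hint : ∀ t : Fin T, Integrable (fun z => |z.1 t - z.2 t| ^ p) π := fun t => by
    refine ⟨(hmeas t).aestronglyMeasurable, ?_⟩
    refine lt_of_eq_of_lt (lintegral_congr fun z => ?_) (hfin t)
    rw [Real.enorm_eq_ofReal (by positivity)]
  refine ⟨π, hc, hb, hint, ?_⟩
  refine (ENNReal.ofReal_le_ofReal_iff (by positivity)).1 ?_
  rw [ENNReal.ofReal_sum_of_nonneg fun t _ => integral_nonneg fun z => by positivity]
  refine le_of_eq_of_le (Finset.sum_congr rfl fun t _ => ?_) hS.le
  exact ofReal_integral_eq_lintegral_ofReal (hint t)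
    (Eventually.of_forall fun z => by positivity)

theorem IsCoupling.measurePreserving_fst {π : Measure ((Fin T → ℝ) × (Fin T → ℝ))}
    (hc : IsCoupling π P Q) : MeasurePreserving Prod.fst π P := ⟨measurable_fst, hc.1⟩

theorem IsCoupling.measurePreserving_snd {π : Measure ((Fin T → ℝ) × (Fin T → ℝ))}
    (hc : IsCoupling π P Q) : MeasurePreserving Prod.snd π Q := ⟨measurable_snd, hc.2⟩

theorem IsCoupling.isProbabilityMeasure {π : Measure ((Fin T → ℝ) × (Fin T → ℝ))}
    (hc : IsCoupling π P Q) [IsProbabilityMeasure P] : IsProbabilityMeasure π := by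
  refine ⟨?_⟩
  rw [← Set.preimage_univ (f := Prod.fst),
    hc.measurePreserving_fst.measure_preimage MeasurableSet.univ.nullMeasurableSet, measure_univ]

/-- Under a causal coupling, the partial derivative in direction `t` acts on the increment
`Y_t - X_t` through its conditional expectation given `X_1, …, X_t` only. -/
theorem IsAdmissibleCost.integral_partialX_mul_eq (hf : IsAdmissibleCost p L P f)
    (hpq : p.HolderConjugate q) (hP : IsModel T p P) (hQ : IsModel T p Q)
    {π : Measure ((Fin T → ℝ) × (Fin T → ℝ))} (hc : IsCoupling π P Q) (hπ : IsCausal π)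
    {a : (Fin T → ℝ) → (Fin T → ℝ)} (ha : a ∈ controls T L) (t : Fin T) :
    ∫ z, partialX f t z.1 (a z.1) * (z.2 t - z.1 t) ∂π
      = ∫ z, condPartial f P a t z.1 * (z.2 t - z.1 t) ∂π := by
  have := hP.1
  have hpr := hc.isProbabilityMeasure
  have hconj : ENNReal.HolderConjugate (ENNReal.ofReal q) (ENNReal.ofReal p) :=
    hpq.symm.ennrealOfReal
  set Z : (Fin T → ℝ) → ℝ := fun x => partialX f t x (a x)
  have hZm : Measurable Z := hf.measurable_partialX measurable_id (measurable_of_mem_controls ha) t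
  have hZ := hf.memLp_partialX_control hpq hP ha t
  have hZi : Integrable Z P := hf.integrable_partialX_control hpq hP ha t
  have hg := hf.memLp_condPartial hpq hP ha t
  have hX := memLp_coord hpq hP t
  have hY := memLp_coord hpq hQ t
  have hfst := hc.measurePreserving_fst
  have hsnd := hc.measurePreserving_snd
  have i1 : Integrable (fun z => Z z.1 * z.2 t) π :=
    (hZ.comp_measurePreserving hfst).integrable_mul (hY.comp_measurePreserving hsnd)
  have i2 : Integrable (fun z => condPartial f P a t z.1 * z.2 t) π :=
    (hg.comp_measurePreserving hfst).integrable_mul (hY.comp_measurePreserving hsnd)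
  have i3 : Integrable (fun x => Z x * x t) P := hZ.integrable_mul hX
  have i4 : Integrable (fun x => condPartial f P a t x * x t) P := hg.integrable_mul hX
  have e1 : ∫ z, Z z.1 * z.2 t ∂π = ∫ z, condPartial f P a t z.1 * z.2 t ∂π := by
    have h := hπ.integral_mul_eq (t := t + 1) (by omega) t.2 hZm (by rwa [hc.1])
      (φ := fun y => y t) (measurable_coord (Nat.lt_succ_self t)) i1
    rw [hc.1] at h
    exact h i2
  have e2 : ∫ x, Z x * x t ∂P = ∫ x, condPartial f P a t x * x t ∂P := by
    rw [← integral_condExp (pathSigma_le T (t + 1))]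
    exact integral_congr_ae (condExp_mul_of_stronglyMeasurable_right
      (measurable_coord (Nat.lt_succ_self t)).stronglyMeasurable i3 hZi)
  have e3 : ∀ w : (Fin T → ℝ) → ℝ, Integrable w P → Integrable (fun z => w z.1) π ∧
      ∫ z, w z.1 ∂π = ∫ x, w x ∂P := fun w hw => by
    refine ⟨hfst.integrable_comp_of_integrable hw, ?_⟩
    have := integral_map (μ := π) (φ := Prod.fst) measurable_fst.aemeasurable (f := w)
      (by rw [hc.1]; exact hw.aestronglyMeasurable)
    rw [hc.1] at this
    exact this.symm
  obtain ⟨j3, k3⟩ := e3 _ i3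
  obtain ⟨j4, k4⟩ := e3 _ i4
  simp only [mul_sub]
  rw [integral_sub i1 j3, integral_sub i2 j4, k3, k4, e1, e2]

/-- The linear part of the increment of the cost is at most the slope times the transport cost, by
Hölder's inequality for `π` and for the sum over times. -/
theorem IsAdmissibleCost.integral_linear_le (hf : IsAdmissibleCost p L P f)
    (hpq : p.HolderConjugate q) (hP : IsModel T p P) (hQ : IsModel T p Q)
    {π : Measure ((Fin T → ℝ) × (Fin T → ℝ))} (hc : IsCoupling π P Q) (hπ : IsCausal π)
    {a : (Fin T → ℝ) → (Fin T → ℝ)} (ha : a ∈ controls T L) {r : ℝ} (hr : 0 ≤ r)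
    (hcost : ∑ t, ∫ z, |z.1 t - z.2 t| ^ p ∂π ≤ r ^ p) :
    ∑ t, ∫ z, partialX f t z.1 (a z.1) * (z.2 t - z.1 t) ∂π ≤ slope q f P a * r := by
  have hfst := hc.measurePreserving_fst
  have hsnd := hc.measurePreserving_snd
  have hconj : ENNReal.HolderConjugate (ENNReal.ofReal q) (ENNReal.ofReal p) :=
    hpq.symm.ennrealOfReal
  set u : Fin T → ℝ := fun t => ∫ x, |condPartial f P a t x| ^ q ∂P
  set w : Fin T → ℝ := fun t => ∫ z, |z.1 t - z.2 t| ^ p ∂π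
  have hu : ∀ t, 0 ≤ u t := fun t => integral_nonneg fun x => by positivity
  have hw : ∀ t, 0 ≤ w t := fun t => integral_nonneg fun x => by positivity
  have hterm : ∀ t, ∫ z, partialX f t z.1 (a z.1) * (z.2 t - z.1 t) ∂π
      ≤ u t ^ (1 / q) * w t ^ (1 / p) := by
    intro t
    rw [hf.integral_partialX_mul_eq hpq hP hQ hc hπ ha t]
    have hg := (hf.memLp_condPartial hpq hP ha t).comp_measurePreserving hfst
    have hd : MemLp (fun z : (Fin T → ℝ) × (Fin T → ℝ) => z.1 t - z.2 t) (ENNReal.ofReal p) π :=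
      ((memLp_coord hpq hP t).comp_measurePreserving hfst).sub
        ((memLp_coord hpq hQ t).comp_measurePreserving hsnd)
    have hd' : MemLp (fun z : (Fin T → ℝ) × (Fin T → ℝ) => z.2 t - z.1 t) (ENNReal.ofReal p) π :=
      ((memLp_coord hpq hQ t).comp_measurePreserving hsnd).sub
        ((memLp_coord hpq hP t).comp_measurePreserving hfst)
    have hol := integral_mul_le_Lp_mul_Lq_of_nonneg hpq.symm
      (μ := π) (f := fun z => |condPartial f P a t z.1|) (g := fun z => |z.1 t - z.2 t|)
      (Eventually.of_forall fun z => abs_nonneg _) (Eventually.of_forall fun z => abs_nonneg _)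
      hg.abs hd.abs
    have hmap : ∫ z, |condPartial f P a t z.1| ^ q ∂π = u t := by
      have hi := integrable_abs_rpow_of_memLp hpq.symm.pos (hf.memLp_condPartial hpq hP ha t)
      have := integral_map (μ := π) (φ := Prod.fst) measurable_fst.aemeasurable
        (f := fun x => |condPartial f P a t x| ^ q)
        (by rw [hc.1]; exact hi.aestronglyMeasurable)
      rw [hc.1] at this
      exact this.symm
    rw [hmap] at hol
    refine le_trans (integral_mono (hg.integrable_mul hd') (hg.abs.integrable_mul hd.abs)
      fun z => ?_) hol
    have hz : condPartial f P a t z.1 * (z.2 t - z.1 t)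
        ≤ |condPartial f P a t z.1| * |z.1 t - z.2 t| := by
      rw [abs_sub_comm, ← abs_mul]
      exact le_abs_self _
    exact hz
  refine (Finset.sum_le_sum fun t _ => hterm t).trans ?_
  have hol := Real.inner_le_Lp_mul_Lq_of_nonneg Finset.univ hpq.symm
    (f := fun t => u t ^ (1 / q)) (g := fun t => w t ^ (1 / p))
    (fun t _ => Real.rpow_nonneg (hu t) _) (fun t _ => Real.rpow_nonneg (hw t) _)
  have e1 : ∀ t, (u t ^ (1 / q)) ^ q = u t := fun t => by
    rw [one_div, Real.rpow_inv_rpow (hu t) hpq.symm.ne_zero]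
  have e2 : ∀ t, (w t ^ (1 / p)) ^ p = w t := fun t => by
    rw [one_div, Real.rpow_inv_rpow (hw t) hpq.ne_zero]
  simp only [e1, e2] at hol
  refine hol.trans (mul_le_mul_of_nonneg_left ?_ (slope_nonneg a))
  calc (∑ t, w t) ^ (1 / p) ≤ (r ^ p) ^ (1 / p) :=
        Real.rpow_le_rpow (Finset.sum_nonneg fun t _ => hw t) hcost
          (by have := hpq.pos; positivity)
    _ = r := by rw [one_div, Real.rpow_rpow_inv hr hpq.ne_zero]

theorem integrable_norm_sub_rpow (hp : 0 < p) {π : Measure ((Fin T → ℝ) × (Fin T → ℝ))}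
    {r : ℝ} (hint : ∀ t, Integrable (fun z => |z.1 t - z.2 t| ^ p) π)
    (hcost : ∑ t, ∫ z, |z.1 t - z.2 t| ^ p ∂π ≤ r ^ p) :
    Integrable (fun z => ‖z.2 - z.1‖ ^ p) π ∧ ∫ z, ‖z.2 - z.1‖ ^ p ∂π ≤ r ^ p := by
  have hle : ∀ z : (Fin T → ℝ) × (Fin T → ℝ), ‖z.2 - z.1‖ ^ p ≤ ∑ t, |z.1 t - z.2 t| ^ p := by
    intro z
    rw [norm_sub_rev]
    exact norm_rpow_le_sum hp (z.1 - z.2)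
  have hs : Integrable (fun z => ∑ t, |z.1 t - z.2 t| ^ p) π :=
    integrable_finsetSum _ fun t _ => hint t
  have hi : Integrable (fun z => ‖z.2 - z.1‖ ^ p) π :=
    hs.mono' ((measurable_snd.sub measurable_fst).norm.pow_const p).aestronglyMeasurable
      (Eventually.of_forall fun z => by
        rw [Real.norm_of_nonneg (by positivity)]; exact hle z)
  refine ⟨hi, (integral_mono hi hs hle).trans ?_⟩
  rwa [integral_finsetSum _ fun t _ => hint t]

theorem IsAdmissibleCost.integral_remainder_le (hf : IsAdmissibleCost p L P f)
    (hpq : p.HolderConjugate q) {π : Measure ((Fin T → ℝ) × (Fin T → ℝ))}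
    (hc : IsCoupling π P Q) {a : (Fin T → ℝ) → (Fin T → ℝ)} (ha : a ∈ controls T L)
    {r η K : ℝ} (hr : 0 ≤ r) (hη : 0 ≤ η) (hK : 0 ≤ K) {A : (Fin T → ℝ) → ℝ} (hAm : Measurable A)
    (hA0 : ∀ x, 0 ≤ A x) (hAq : MemLp A (ENNReal.ofReal q) P)
    (hAη : (∫ x, A x ^ q ∂P) ^ (1 / q) ≤ η)
    (hW : ∀ x h, |remainder f (a x) x h| ≤ A x * ‖h‖ + K * ‖h‖ ^ p)
    (hi : Integrable (fun z => ‖z.2 - z.1‖ ^ p) π)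
    (hir : ∫ z, ‖z.2 - z.1‖ ^ p ∂π ≤ r ^ p) :
    Integrable (fun z => remainder f (a z.1) z.1 (z.2 - z.1)) π ∧
      ∫ z, remainder f (a z.1) z.1 (z.2 - z.1) ∂π ≤ η * r + K * r ^ p := by
  have hfst := hc.measurePreserving_fst
  have hconj : ENNReal.HolderConjugate (ENNReal.ofReal q) (ENNReal.ofReal p) :=
    hpq.symm.ennrealOfReal
  have hA' : MemLp (fun z : (Fin T → ℝ) × (Fin T → ℝ) => A z.1) (ENNReal.ofReal q) π :=
    hAq.comp_measurePreserving hfst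
  have hd : MemLp (fun z : (Fin T → ℝ) × (Fin T → ℝ) => ‖z.2 - z.1‖) (ENNReal.ofReal p) π :=
    (memLp_of_integrable_norm_rpow hpq.lt (measurable_snd.sub measurable_fst) hi).norm
  have hmul : Integrable (fun z => A z.1 * ‖z.2 - z.1‖) π := hA'.integrable_mul hd
  have hbound : Integrable (fun z => A z.1 * ‖z.2 - z.1‖ + K * ‖z.2 - z.1‖ ^ p) π :=
    hmul.add (hi.const_mul K)
  have ham := measurable_of_mem_controls ha
  have hWm : Measurable fun z : (Fin T → ℝ) × (Fin T → ℝ) =>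
      remainder f (a z.1) z.1 (z.2 - z.1) := by
    unfold remainder
    refine ((hf.measurable_comp (measurable_fst.add (measurable_snd.sub measurable_fst))
      (ham.comp measurable_fst)).sub
        (hf.measurable_comp measurable_fst (ham.comp measurable_fst))).sub ?_
    exact Finset.measurable_sum _ fun t _ =>
      (hf.measurable_partialX measurable_fst (ham.comp measurable_fst) t).mul (by fun_prop)
  have hWi : Integrable (fun z => remainder f (a z.1) z.1 (z.2 - z.1)) π :=
    hbound.mono' hWm.aestronglyMeasurable (Eventually.of_forall fun z => hW _ _)
  refine ⟨hWi, (integral_mono hWi hbound fun z => (le_abs_self _).trans (hW _ _)).trans ?_⟩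
  rw [integral_add hmul (hi.const_mul K), integral_const_mul]
  refine add_le_add ?_ (mul_le_mul_of_nonneg_left hir hK)
  refine (integral_mul_le_Lp_mul_Lq_of_nonneg hpq.symm (Eventually.of_forall fun z => hA0 z.1)
    (Eventually.of_forall fun z => norm_nonneg _) hA' hd).trans ?_
  have hmap : ∫ z, A z.1 ^ q ∂π = ∫ x, A x ^ q ∂P := by
    have := integral_map (μ := π) (φ := Prod.fst) measurable_fst.aemeasurable
      (f := fun x => A x ^ q) (hAm.pow_const q).aestronglyMeasurable
    rw [hc.1] at this
    exact this.symm
  rw [hmap]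
  refine mul_le_mul hAη ?_ (Real.rpow_nonneg (integral_nonneg fun z => by positivity) _) hη
  calc (∫ z, ‖z.2 - z.1‖ ^ p ∂π) ^ (1 / p) ≤ (r ^ p) ^ (1 / p) :=
        Real.rpow_le_rpow (integral_nonneg fun z => by positivity) hir
          (by have := hpq.pos; positivity)
    _ = r := by rw [one_div, Real.rpow_rpow_inv hr hpq.ne_zero]

/-- First-order upper bound for the value on the ball. The optimal control for `P` is transported to
`Q` along a nearly optimal bicausal coupling, and the cost is then linearized at `X`. -/
theorem IsAdmissibleCost.value_le_of_mem_ball (hf : IsAdmissibleCost p L P f)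
    (hpq : p.HolderConjugate q) (hL : 0 ≤ L) (hP : IsModel T p P)
    {a : (Fin T → ℝ) → (Fin T → ℝ)} (ha : a ∈ controls T L) (hopt : value L f P = cost f P a)
    {η : ℝ} (hη : 0 < η) :
    ∃ K : ℝ, 0 ≤ K ∧ ∀ r, 0 ≤ r → ∀ Q ∈ ball p P r,
      value L f Q ≤ value L f P + r * slope q f P a + (η * r + K * r ^ p) := by
  have hp := hpq.lt
  have := hP.1
  obtain ⟨K, hK, A, hAm, hA0, hAq, hAη, hW⟩ := hf.exists_remainder_le hpq hP ha hη
  refine ⟨K, hK, fun r hr Q hQ => ?_⟩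
  obtain ⟨hQ, hdist⟩ := hQ
  -- The infimum over couplings need not be attained, so the radius is first enlarged to `r' > r`.
  have key : ∀ r', r < r' →
      value L f Q ≤ value L f P + r' * slope q f P a + (η * r' + K * r' ^ p) := by
    intro r' hrr'
    have hr' : 0 ≤ r' := hr.trans hrr'.le
    obtain ⟨π, hc, hb, hint, hcost⟩ := exists_coupling_of_adaptedW_le hpq.pos hr hrr' hdist
    have hpr := hc.isProbabilityMeasure
    have hfst := hc.measurePreserving_fst
    have hsnd := hc.measurePreserving_snd
    have ham := measurable_of_mem_controls ha
    have hX : Integrable (fun z : (Fin T → ℝ) × (Fin T → ℝ) => ‖z.1‖ ^ p) π :=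
      hfst.integrable_comp_of_integrable (hP.integrable_norm_rpow hpq.pos)
    have hY : Integrable (fun z : (Fin T → ℝ) × (Fin T → ℝ) => ‖z.2‖ ^ p) π :=
      hsnd.integrable_comp_of_integrable (hQ.integrable_norm_rpow hpq.pos)
    have hpr' : IsProbabilityMeasure (π.map Prod.swap) :=
      Measure.isProbabilityMeasure_map measurable_swap.aemeasurable
    have hYswap : Integrable (fun z : (Fin T → ℝ) × (Fin T → ℝ) => ‖z.1‖ ^ p) (π.map Prod.swap) :=
      (integrable_map_measure ((measurable_fst.norm.pow_const p).aestronglyMeasurable)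
        measurable_swap.aemeasurable).2 hY
    obtain ⟨b, hbc, hble⟩ := hb.2.exists_control_le hL hf.measurable_uncurry hf.convex
      (fun x => (hf.contDiff x).continuous)
      (fun A hA hAL => hf.integrable_comp hp measurable_fst hA hAL hYswap) ha
    have hbm := measurable_of_mem_controls hbc
    have hmb : Measurable fun z : (Fin T → ℝ) × (Fin T → ℝ) => f z.1 (b z.1) :=
      hf.measurable_comp measurable_fst (hbm.comp measurable_fst)
    have hma : Measurable fun z : (Fin T → ℝ) × (Fin T → ℝ) => f z.1 (a z.2) :=
      hf.measurable_comp measurable_fst (ham.comp measurable_snd)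
    rw [integral_map measurable_swap.aemeasurable hmb.aestronglyMeasurable,
      integral_map measurable_swap.aemeasurable hma.aestronglyMeasurable] at hble
    simp only [Prod.fst_swap, Prod.snd_swap] at hble
    have hcQ : cost f Q b = ∫ z, f z.2 (b z.2) ∂π := by
      have h := integral_map (μ := π) (φ := Prod.snd) measurable_snd.aemeasurable
        (f := fun y => f y (b y)) (hf.measurable_comp measurable_id hbm).aestronglyMeasurable
      rw [hc.2] at h
      exact h
    have hcP : cost f P a = ∫ z, f z.1 (a z.1) ∂π := by
      have h := integral_map (μ := π) (φ := Prod.fst) measurable_fst.aemeasurable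
        (f := fun y => f y (a y)) (hf.measurable_comp measurable_id ham).aestronglyMeasurable
      rw [hc.1] at h
      exact h
    obtain ⟨hi, hir⟩ := integrable_norm_sub_rpow hpq.pos hint hcost
    obtain ⟨hWi, hWle⟩ := hf.integral_remainder_le hpq hc ha hr' hη.le hK hAm hA0 hAq hAη hW hi hir
    have hlin := hf.integral_linear_le hpq hP hQ hc hb.1 ha hr' hcost
    have hconj : ENNReal.HolderConjugate (ENNReal.ofReal q) (ENNReal.ofReal p) :=
      hpq.symm.ennrealOfReal
    have hli : ∀ t, Integrable (fun z => partialX f t z.1 (a z.1) * (z.2 t - z.1 t)) π := fun t =>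
      ((hf.memLp_partialX_control hpq hP ha t).comp_measurePreserving hfst).integrable_mul
        (((memLp_coord hpq hQ t).comp_measurePreserving hsnd).sub
          ((memLp_coord hpq hP t).comp_measurePreserving hfst))
    have hsum : Integrable
        (fun z => ∑ t, partialX f t z.1 (a z.1) * (z.2 t - z.1 t)) π :=
      integrable_finsetSum _ fun t _ => hli t
    have hfa : Integrable (fun z => f z.1 (a z.1)) π :=
      hf.integrable_comp hp measurable_fst (ham.comp measurable_fst) (fun z => ha.2 z.1) hX
    have hfs : Integrable
        (fun z => f z.1 (a z.1) + ∑ t, partialX f t z.1 (a z.1) * (z.2 t - z.1 t)) π :=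
      hfa.add hsum
    have hdecomp : ∫ z, f z.2 (a z.1) ∂π = cost f P a
        + ∑ t, ∫ z, partialX f t z.1 (a z.1) * (z.2 t - z.1 t) ∂π
        + ∫ z, remainder f (a z.1) z.1 (z.2 - z.1) ∂π := by
      rw [hcP, ← integral_finsetSum _ fun t _ => hli t,
        ← integral_add hfa hsum, ← integral_add hfs hWi]
      refine integral_congr_ae (Eventually.of_forall fun z => ?_)
      simp [remainder]
    have hval := hf.value_le_cost hp hQ hbc
    linarith
  have hcont : Tendsto (fun r' => value L f P + r' * slope q f P a + (η * r' + K * r' ^ p))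
      (𝓝[>] r) (𝓝 (value L f P + r * slope q f P a + (η * r + K * r ^ p))) := by
    have : ContinuousAt (fun r' => value L f P + r' * slope q f P a + (η * r' + K * r' ^ p)) r := by
      have := Real.continuousAt_rpow_const r p (Or.inr (by linarith))
      fun_prop
    exact this.tendsto.mono_left nhdsWithin_le_nhds
  exact ge_of_tendsto hcont (eventually_mem_nhdsWithin.mono fun r' hr' => key r' hr')

end Upper

/-! ### Perturbed models -/

section Perturb

variable {T : ℕ} {p q L : ℝ} {P : Measure (Fin T → ℝ)} {f : (Fin T → ℝ) → (Fin T → ℝ) → ℝ}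

theorem IsAdapted.const_smul {Z : (Fin T → ℝ) → (Fin T → ℝ)} (hZ : IsAdapted Z) (r : ℝ) :
    IsAdapted fun x => r • Z x := fun s => (hZ s).const_mul r

theorem IsAdapted.id_add {Z : (Fin T → ℝ) → (Fin T → ℝ)} (hZ : IsAdapted Z) :
    IsAdapted fun x => x + Z x := fun s => (measurable_coord (Nat.lt_succ_self s)).add (hZ s)

theorem map_add_smul_mem_ball (hp : 1 < p) (hP : IsModel T p P) {Z : (Fin T → ℝ) → (Fin T → ℝ)}
    (hZ : IsAdapted Z) {K : NNReal} (hlip : LipschitzWith K Z) {M : ℝ} (hM : ∀ x, ‖Z x‖ ≤ M)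
    (hnorm : ∑ t, ∫ x, |Z x t| ^ p ∂P ≤ 1) {r : ℝ} (hr : 0 ≤ r) (hrK : r * K < 1) :
    P.map (fun x => x + r • Z x) ∈ ball p P r := by
  have := hP.1
  have hp0 : 0 < p := by linarith
  have hrZ := hZ.const_smul r
  have hG := hrZ.id_add
  have hZb : Integrable (fun x => ‖r • Z x‖ ^ p) P := by
    refine Integrable.of_bound (hrZ.measurable.norm.pow_const p).aestronglyMeasurable
      ((r * M) ^ p) (Eventually.of_forall fun x => ?_)
    rw [Real.norm_of_nonneg (by positivity), norm_smul, Real.norm_of_nonneg hr]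
    exact Real.rpow_le_rpow (by positivity) (mul_le_mul_of_nonneg_left (hM x) hr) hp0.le
  refine ⟨isModel_of_integrable hp0
    (Measure.isProbabilityMeasure_map hG.measurable.aemeasurable) ?_, ?_⟩
  · refine (integrable_map_measure (measurable_norm.pow_const p).aestronglyMeasurable
      hG.measurable.aemeasurable).2 ?_
    exact integrable_norm_add_rpow hp measurable_id hrZ.measurable
      (hP.integrable_norm_rpow hp0) hZb
  · have hlip' : LipschitzWith (r.toNNReal * K) fun x => r • Z x := by
      refine LipschitzWith.of_dist_le_mul fun x y => ?_
      rw [dist_eq_norm, ← smul_sub, norm_smul, Real.norm_of_nonneg hr, NNReal.coe_mul,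
        Real.coe_toNNReal r hr, mul_assoc]
      exact mul_le_mul_of_nonneg_left (hlip.norm_sub_le x y) hr
    have hK' : r.toNNReal * K < 1 := by
      rw [← NNReal.coe_lt_coe, NNReal.coe_mul, Real.coe_toNNReal r hr]
      exact hrK
    obtain ⟨H, hH, hHG⟩ := exists_isAdapted_leftInverse hrZ hK' hlip'
    refine (adaptedW_map_le p P hG hH hHG).trans ?_
    have hi : ∀ t, Integrable (fun x => |Z x t| ^ p) P := fun t => by
      have hm : Measurable fun x => Z x t := (hZ t).mono (pathSigma_le T _) le_rfl
      refine Integrable.of_bound (hm.norm.pow_const p).aestronglyMeasurable (M ^ p)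
        (Eventually.of_forall fun x => ?_)
      rw [Real.norm_of_nonneg (by positivity)]
      exact Real.rpow_le_rpow (abs_nonneg _) ((norm_le_pi_norm (Z x) t).trans (hM x)) hp0.le
    have hterm : ∀ t, ∫⁻ x, ENNReal.ofReal (|x t - (x + r • Z x) t| ^ p) ∂P
        = ENNReal.ofReal (r ^ p * ∫ x, |Z x t| ^ p ∂P) := by
      intro t
      rw [← integral_const_mul, ofReal_integral_eq_lintegral_ofReal ((hi t).const_mul _)
        (Eventually.of_forall fun x => by positivity)]
      refine lintegral_congr fun x => ?_
      rw [Pi.add_apply, sub_add_cancel_left, abs_neg, Pi.smul_apply, smul_eq_mul, abs_mul,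
        Real.mul_rpow (abs_nonneg _) (abs_nonneg _), abs_of_nonneg hr]
    simp only [hterm]
    have hle : ∑ t, r ^ p * ∫ x, |Z x t| ^ p ∂P ≤ r ^ p := by
      rw [← Finset.mul_sum]
      exact mul_le_of_le_one_right (by positivity) hnorm
    rw [← ENNReal.ofReal_sum_of_nonneg fun t _ =>
        mul_nonneg (by positivity) (integral_nonneg fun x => by positivity),
      one_div, ENNReal.rpow_inv_le_iff hp0, ENNReal.ofReal_rpow_of_nonneg hr hp0.le]
    exact ENNReal.ofReal_le_ofReal hle

/-- Mean value theorem for the cost along `r z`. -/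
theorem IsAdmissibleCost.exists_increment_eq (hf : IsAdmissibleCost p L P f) (x z a : Fin T → ℝ)
    (r : ℝ) : ∃ y, ‖y - x‖ ≤ ‖r • z‖ ∧
      f (x + r • z) a - f x a = r * ∑ t, partialX f t y a * z t := by
  obtain ⟨y, hy, hval⟩ := domain_mvt (f := fun x => f x a) (s := Set.univ) (x := x)
    (y := x + r • z) (f' := fun y => fderiv ℝ (fun x => f x a) y)
    (fun y _ => (hf.differentiable a y).hasFDerivAt.hasFDerivWithinAt) convex_univ
    (Set.mem_univ _) (Set.mem_univ _)
  refine ⟨y, ?_, ?_⟩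
  · rw [segment_eq_image'] at hy
    obtain ⟨θ, ⟨h0, h1⟩, rfl⟩ := hy
    rw [add_sub_cancel_left, add_sub_cancel_left, norm_smul, Real.norm_of_nonneg h0]
    exact mul_le_of_le_one_left (norm_nonneg _) h1
  · simp only [add_sub_cancel_left, fderiv_apply_eq_sum] at hval
    rw [hval, Finset.mul_sum]
    refine Finset.sum_congr rfl fun t _ => ?_
    simp only [Pi.smul_apply, smul_eq_mul]
    ring

/-- Lower bound for the directional derivative of the value along an adapted perturbation of `P`.
Nearly optimal controls for the perturbed models, read as functions of the unperturbed path, form a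
minimizing sequence for `P`, hence converge almost surely to the optimal control `a` along a
subsequence; the difference quotients of the cost then converge by dominated convergence. -/
theorem IsAdmissibleCost.eventually_le_value_map (hf : IsAdmissibleCost p L P f) (hp : 1 < p)
    (hL : 0 ≤ L) (hP : IsModel T p P) {a : (Fin T → ℝ) → (Fin T → ℝ)} (ha : a ∈ controls T L)
    (hopt : value L f P = cost f P a) {Z : (Fin T → ℝ) → (Fin T → ℝ)} (hZ : IsAdapted Z)
    {M : ℝ} (hM : ∀ x, ‖Z x‖ ≤ M) {ℓ : ℝ}
    (hℓ : ℓ < ∫ x, ∑ t, partialX f t x (a x) * Z x t ∂P) :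
    ∀ᶠ r in 𝓝[>] (0 : ℝ), value L f P + r * ℓ ≤ value L f (P.map fun x => x + r • Z x) := by
  have := hP.1
  by_contra hcon
  have hfreq : ∃ᶠ r in 𝓝[>] (0 : ℝ), (0 < r ∧ r < 1) ∧
      value L f (P.map fun x => x + r • Z x) < value L f P + r * ℓ := by
    rw [not_eventually] at hcon
    have hev : ∀ᶠ r in 𝓝[>] (0 : ℝ), 0 < r ∧ r < 1 :=
      Ioo_mem_nhdsGT (zero_lt_one)
    exact (hcon.and_eventually hev).mono fun r hr => ⟨hr.2, not_le.1 hr.1⟩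
  obtain ⟨r, hr0, hr⟩ := exists_seq_forall_of_frequently hfreq
  have hM0 : 0 ≤ M := (norm_nonneg _).trans (hM 0)
  have hG : ∀ n, IsAdapted fun x => x + r n • Z x := fun n => (hZ.const_smul (r n)).id_add
  have hex : ∀ n, ∃ b ∈ controls T L,
      cost f (P.map fun x => x + r n • Z x) b < value L f P + r n * ℓ := fun n => by
    obtain ⟨_, ⟨b, hb, rfl⟩, h⟩ := exists_lt_of_csInf_lt (cost_image_nonempty (f := f) hL _) (hr n).2
    exact ⟨b, hb, h⟩
  choose b hb hbcost using hex
  set α : ℕ → (Fin T → ℝ) → (Fin T → ℝ) := fun n x => b n (x + r n • Z x)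
  have hα : ∀ n, α n ∈ controls T L := fun n =>
    ⟨fun t => ((hb n).1 t).comp ((hG n).measurable_pathSigma t), fun x => (hb n).2 _⟩
  have hcost : ∀ n, cost f (P.map fun x => x + r n • Z x) (b n)
      = ∫ x, f (x + r n • Z x) (α n x) ∂P := fun n =>
    integral_map (hG n).measurable.aemeasurable
      (hf.measurable_comp measurable_id (measurable_of_mem_controls (hb n))).aestronglyMeasurable
  obtain ⟨C, hC, -, hinc⟩ := hf.exists_increment hp
  set D : (Fin T → ℝ) → ℝ := fun x => C * (1 + ‖x‖ ^ (p - 1) + M ^ (p - 1)) * M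
  have hDi : Integrable D P := by
    have hpq := Real.HolderConjugate.conjExponent hp
    have h1 := (memLp_norm_rpow_sub_one hpq measurable_id
      (hP.integrable_norm_rpow (by linarith))).integrable (one_le_ofReal_of_holderConjugate hpq)
    exact ((((integrable_const (1 : ℝ)).add h1).add
      (integrable_const (M ^ (p - 1)))).const_mul C).mul_const M
  have hD : ∀ n x, |f (x + r n • Z x) (α n x) - f x (α n x)| ≤ r n * D x := by
    intro n x
    obtain ⟨⟨hr1, hr2⟩, -⟩ := hr n
    have hn : ‖r n • Z x‖ ≤ r n * M := by
      rw [norm_smul, Real.norm_of_nonneg hr1.le]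
      exact mul_le_mul_of_nonneg_left (hM x) hr1.le
    have hn' : ‖r n • Z x‖ ≤ M := hn.trans (mul_le_of_le_one_left hM0 hr2.le)
    have h2 : ‖r n • Z x‖ ^ (p - 1) ≤ M ^ (p - 1) :=
      Real.rpow_le_rpow (norm_nonneg _) hn' (by linarith)
    calc |f (x + r n • Z x) (α n x) - f x (α n x)|
        ≤ C * (1 + ‖x‖ ^ (p - 1) + ‖r n • Z x‖ ^ (p - 1)) * ‖r n • Z x‖ :=
          hinc _ _ _ ((hα n).2 x)
      _ ≤ C * (1 + ‖x‖ ^ (p - 1) + M ^ (p - 1)) * (r n * M) := by gcongr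
      _ = r n * D x := by simp only [D]; ring
  have hi1 : ∀ n, Integrable (fun x => f x (α n x)) P := fun n => hf.integrable_cost hp hP (hα n)
  have hmd : ∀ n, Measurable fun x => f (x + r n • Z x) (α n x) - f x (α n x) := fun n =>
    (hf.measurable_comp (hG n).measurable (measurable_of_mem_controls (hα n))).sub
      (hf.measurable_comp measurable_id (measurable_of_mem_controls (hα n)))
  have hid : ∀ n, Integrable (fun x => f (x + r n • Z x) (α n x) - f x (α n x)) P := fun n =>
    (hDi.const_mul (r n)).mono' (hmd n).aestronglyMeasurable (Eventually.of_forall (hD n))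
  have hsplit : ∀ n, ∫ x, f (x + r n • Z x) (α n x) ∂P
      = cost f P (α n) + ∫ x, (f (x + r n • Z x) (α n x) - f x (α n x)) ∂P := by
    intro n
    rw [cost, ← integral_add (hi1 n) (hid n)]
    simp
  have hr0' : Tendsto r atTop (𝓝 0) := hr0.mono_right nhdsWithin_le_nhds
  have hmin : Tendsto (fun n => cost f P (α n)) atTop (𝓝 (value L f P)) := by
    have hup : Tendsto (fun n => value L f P + r n * (ℓ + ∫ x, D x ∂P)) atTop
        (𝓝 (value L f P + 0 * (ℓ + ∫ x, D x ∂P))) :=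
      tendsto_const_nhds.add (hr0'.mul_const _)
    rw [zero_mul, add_zero] at hup
    refine tendsto_of_tendsto_of_tendsto_of_le_of_le tendsto_const_nhds hup
      (fun n => hf.value_le_cost hp hP (hα n)) fun n => ?_
    have h1 := hbcost n
    rw [hcost, hsplit] at h1
    have h2 : |∫ x, (f (x + r n • Z x) (α n x) - f x (α n x)) ∂P| ≤ ∫ x, r n * D x ∂P :=
      norm_integral_le_of_norm_le (f := fun x => f (x + r n • Z x) (α n x) - f x (α n x))
        (hDi.const_mul _) (Eventually.of_forall (hD n))
    rw [integral_const_mul] at h2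
    have h3 := (abs_le.1 h2).1
    simp only
    rw [mul_add]
    linarith
  obtain ⟨ns, hns, hae⟩ := hf.exists_subseq_tendsto hp hP ha hopt hα hmin
  have hrns : Tendsto (fun k => r (ns k)) atTop (𝓝 0) := hr0'.comp hns.tendsto_atTop
  have hquot : Tendsto (fun k => ∫ x, (r (ns k))⁻¹ *
      (f (x + r (ns k) • Z x) (α (ns k) x) - f x (α (ns k) x)) ∂P) atTop
      (𝓝 (∫ x, ∑ t, partialX f t x (a x) * Z x t ∂P)) := by
    refine tendsto_integral_of_dominated_convergence D
      (fun k => ((hmd _).const_mul _).aestronglyMeasurable) hDi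
      (fun k => Eventually.of_forall fun x => ?_) ?_
    · have hpos := (hr (ns k)).1.1
      rw [norm_mul, norm_inv, Real.norm_of_nonneg hpos.le, inv_mul_le_iff₀ hpos]
      exact hD _ x
    · filter_upwards [hae] with x hx
      choose y hy hyval using fun k =>
        hf.exists_increment_eq x (Z x) (α (ns k) x) (r (ns k))
      have hyx : Tendsto y atTop (𝓝 x) := by
        refine tendsto_iff_norm_sub_tendsto_zero.2 (squeeze_zero (fun k => norm_nonneg _) hy ?_)
        simpa using (hrns.smul_const (Z x)).norm
      have heq : (fun k => (r (ns k))⁻¹ *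
          (f (x + r (ns k) • Z x) (α (ns k) x) - f x (α (ns k) x)))
          = fun k => ∑ t, partialX f t (y k) (α (ns k) x) * Z x t := by
        ext k
        rw [hyval, inv_mul_cancel_left₀ (hr (ns k)).1.1.ne']
      rw [heq]
      refine tendsto_finsetSum _ fun t _ => Tendsto.mul_const _ ?_
      exact ((hf.continuous t).tendsto (x, a x)).comp (hyx.prodMk_nhds hx)
  refine absurd (le_of_tendsto' hquot fun k => ?_) (not_le.2 hℓ)
  have hpos := (hr (ns k)).1.1
  rw [integral_const_mul, inv_mul_le_iff₀ hpos]
  have h1 := hbcost (ns k)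
  rw [hcost, hsplit] at h1
  have h2 := hf.value_le_cost hp hP (hα (ns k))
  linarith

end Perturb

/-! ### Extremal adapted directions -/

section Extremal

variable {T : ℕ} {p q L : ℝ} {P : Measure (Fin T → ℝ)} {f : (Fin T → ℝ) → (Fin T → ℝ) → ℝ}

/-- Functions of the path up to time `k` are `L^p`-limits of bounded Lipschitz functions of the path
up to time `k`: apply the density of smooth compactly supported functions to the law of the
truncated path. -/
theorem exists_lipschitz_approx (hp : 1 < p) [IsProbabilityMeasure P] {k : ℕ}
    {h : (Fin T → ℝ) → ℝ} (hm : Measurable[pathSigma T k] h) (hh : MemLp h (ENNReal.ofReal p) P)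
    {δ : ℝ} (hδ : 0 < δ) :
    ∃ Z : (Fin T → ℝ) → ℝ, Measurable[pathSigma T k] Z ∧ (∃ K, LipschitzWith K Z) ∧
      (∃ M, ∀ x, |Z x| ≤ M) ∧ MemLp Z (ENNReal.ofReal p) P ∧
      lpNorm (h - Z) (ENNReal.ofReal p) P ≤ δ := by
  obtain ⟨h', hm', rfl⟩ := exists_eq_comp_truncate hm
  have htr : Measurable (truncate k : (Fin T → ℝ) → _) := (continuous_truncate k).measurable
  have hpr : IsProbabilityMeasure (P.map (truncate k)) :=
    Measure.isProbabilityMeasure_map htr.aemeasurable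
  have hh' : MemLp h' (ENNReal.ofReal p) (P.map (truncate k)) :=
    (memLp_map_measure_iff hm'.aestronglyMeasurable htr.aemeasurable).2 hh
  obtain ⟨φ, hφc, hφs, hφ⟩ := hh'.exist_eLpNorm_sub_le ENNReal.ofReal_ne_top
    (by simpa using ENNReal.ofReal_le_ofReal hp.le) hδ
  obtain ⟨K, hK⟩ := ContDiff.lipschitzWith_of_hasCompactSupport hφc hφs (by simp)
  obtain ⟨M, hM⟩ := hφc.exists_bound_of_continuous hφs.continuous
  have hZm : Measurable (φ ∘ truncate k) := hφs.continuous.measurable.comp htr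
  refine ⟨φ ∘ truncate k, hφs.continuous.measurable.comp (measurable_truncate T k), ⟨K, ?_⟩,
    ⟨M, fun x => hM _⟩, MemLp.of_bound hZm.aestronglyMeasurable M
      (Eventually.of_forall fun x => hM _), ?_⟩
  · refine LipschitzWith.of_dist_le_mul fun x y => (hK.dist_le_mul _ _).trans ?_
    rw [dist_eq_norm, dist_eq_norm]
    exact mul_le_mul_of_nonneg_left (norm_truncate_sub_le k x y) K.2
  · have hsub : (h' - φ) ∘ truncate k = h' ∘ truncate k - φ ∘ truncate k := rfl
    rw [← toReal_eLpNorm (hh.aestronglyMeasurable.sub hZm.aestronglyMeasurable), ← hsub,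
      ← eLpNorm_map_measure (hm'.sub hφs.continuous.measurable).aestronglyMeasurable
        htr.aemeasurable]
    exact ENNReal.toReal_le_of_le_ofReal hδ.le hφ

theorem lpNorm_rpow_eq_integral {Ω : Type*} [MeasurableSpace Ω] {ρ : Measure Ω} {g : Ω → ℝ} {s : ℝ}
    (hs : 0 < s) (hg : MemLp g (ENNReal.ofReal s) ρ) :
    lpNorm g (ENNReal.ofReal s) ρ ^ s = ∫ ω, |g ω| ^ s ∂ρ := by
  rw [lpNorm_eq_integral_norm_rpow_toReal (by simpa using hs) ENNReal.ofReal_ne_top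
    hg.aestronglyMeasurable, ENNReal.toReal_ofReal hs.le,
    Real.rpow_inv_rpow (integral_nonneg fun _ => by positivity) hs.ne']
  rfl

theorem abs_integral_mul_le_lpNorm {Ω : Type*} [MeasurableSpace Ω] {ρ : Measure Ω} {g w : Ω → ℝ}
    (hpq : p.HolderConjugate q) (hg : MemLp g (ENNReal.ofReal q) ρ)
    (hw : MemLp w (ENNReal.ofReal p) ρ) :
    |∫ ω, g ω * w ω ∂ρ| ≤ lpNorm g (ENNReal.ofReal q) ρ * lpNorm w (ENNReal.ofReal p) ρ := by
  refine (abs_integral_le_integral_abs).trans ?_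
  simp only [abs_mul]
  refine (integral_mul_le_Lp_mul_Lq_of_nonneg hpq.symm (Eventually.of_forall fun _ => abs_nonneg _)
    (Eventually.of_forall fun _ => abs_nonneg _) hg.abs hw.abs).trans_eq ?_
  rw [← lpNorm_rpow_eq_integral hpq.pos hw, ← lpNorm_rpow_eq_integral hpq.symm.pos hg, one_div,
    one_div, Real.rpow_rpow_inv lpNorm_nonneg hpq.ne_zero,
    Real.rpow_rpow_inv lpNorm_nonneg hpq.symm.ne_zero]

/-- The adapted direction `sign(g_t) |g_t|^(q-1)`, normalized, attains equality in Hölder's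
inequality. -/
theorem IsAdmissibleCost.exists_extremal (hf : IsAdmissibleCost p L P f)
    (hpq : p.HolderConjugate q) (hP : IsModel T p P) {a : (Fin T → ℝ) → (Fin T → ℝ)}
    (ha : a ∈ controls T L) (hV : 0 < slope q f P a) :
    ∃ Z : Fin T → (Fin T → ℝ) → ℝ, (∀ t : Fin T, Measurable[pathSigma T (t + 1)] (Z t)) ∧
      (∀ t, MemLp (Z t) (ENNReal.ofReal p) P) ∧ ∑ t, ∫ x, |Z t x| ^ p ∂P = 1 ∧
      ∑ t, ∫ x, condPartial f P a t x * Z t x ∂P = slope q f P a := by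
  set V := slope q f P a with hVdef
  have hq0 := hpq.symm.pos
  have hq1 := hpq.symm.lt
  have hVq : V ^ q = ∑ t, ∫ x, |condPartial f P a t x| ^ q ∂P := by
    rw [hVdef, slope, one_div, Real.rpow_inv_rpow _ hq0.ne']
    exact Finset.sum_nonneg fun _ _ => integral_nonneg fun _ => by positivity
  -- `u s = sign(s) |s| ^ (q - 1) / V ^ (q - 1)`, also at `s = 0`.
  set u : ℝ → ℝ := fun s => s * |s| ^ (q - 2) / V ^ (q - 1) with hu
  have hum : Measurable u := by fun_prop
  have habs : ∀ s : ℝ, |s| * |s| ^ (q - 2) = |s| ^ (q - 1) := fun s => by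
    rcases eq_or_ne s 0 with rfl | hs
    · simp [Real.zero_rpow (by linarith : q - 1 ≠ 0)]
    · rw [← Real.rpow_one_add' (abs_nonneg s) (by linarith)]
      congr 1
      ring
  have hup : ∀ s, |u s| ^ p = |s| ^ q / V ^ q := fun s => by
    have hqp : (q - 1) * p = q := hpq.symm.sub_one_mul_conj
    simp only [hu, abs_div, abs_mul]
    rw [abs_of_nonneg (by positivity : 0 ≤ |s| ^ (q - 2)), habs,
      abs_of_nonneg (by positivity : 0 ≤ V ^ (q - 1)), Real.div_rpow (by positivity)
      (by positivity), ← Real.rpow_mul (abs_nonneg s), ← Real.rpow_mul hV.le, hqp]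
  have hsu : ∀ s, s * u s = |s| ^ q / V ^ (q - 1) := fun s => by
    have : s * (s * |s| ^ (q - 2)) = |s| ^ q := by
      rw [← mul_assoc, ← abs_mul_abs_self s, mul_assoc, habs,
        ← Real.rpow_one_add' (abs_nonneg s) (by linarith)]
      congr 1
      ring
    rw [← this]
    simp only [hu]
    ring
  have hgm : ∀ t : Fin T, Measurable[pathSigma T (t + 1)] (condPartial f P a t) := fun t =>
    stronglyMeasurable_condExp.measurable
  have hgq := fun t => integrable_abs_rpow_of_memLp hq0 (hf.memLp_condPartial hpq hP ha t)
  refine ⟨fun t x => u (condPartial f P a t x), fun t => hum.comp (hgm t), fun t => ?_, ?_, ?_⟩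
  · have hm : Measurable fun x => u (condPartial f P a t x) :=
      hum.comp ((hgm t).mono (pathSigma_le T _) le_rfl)
    refine (integrable_norm_rpow_iff hm.aestronglyMeasurable (by simpa using hpq.pos)
      ENNReal.ofReal_ne_top).1 ?_
    rw [ENNReal.toReal_ofReal hpq.pos.le]
    simp only [Real.norm_eq_abs, hup]
    exact (hgq t).div_const _
  · simp only [hup, integral_div]
    rw [← Finset.sum_div, ← hVq, div_self (by positivity)]
  · simp only [hsu, integral_div]
    rw [← Finset.sum_div, ← hVq, Real.rpow_sub_one hV.ne']
    have : V ^ q ≠ 0 := by positivity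
    field_simp

/-- Bounded Lipschitz adapted directions of unit cost nearly attain the slope. -/
theorem IsAdmissibleCost.exists_direction (hf : IsAdmissibleCost p L P f)
    (hpq : p.HolderConjugate q) (hP : IsModel T p P) {a : (Fin T → ℝ) → (Fin T → ℝ)}
    (ha : a ∈ controls T L) {η : ℝ} (hη : 0 < η) :
    ∃ Z : (Fin T → ℝ) → (Fin T → ℝ), IsAdapted Z ∧ (∃ K, LipschitzWith K Z) ∧
      (∃ M, ∀ x, ‖Z x‖ ≤ M) ∧ ∑ t, ∫ x, |Z x t| ^ p ∂P ≤ 1 ∧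
      slope q f P a - η < ∫ x, ∑ t, partialX f t x (a x) * Z x t ∂P := by
  have := hP.1
  have hp := hpq.lt
  have hp0 := hpq.pos
  rcases (slope_nonneg (q := q) (f := f) (P := P) a).eq_or_lt with hV | hV
  · refine ⟨fun _ => 0, fun _ => measurable_const, ⟨0, LipschitzWith.const 0⟩,
      ⟨0, fun x => by simp⟩, ?_, ?_⟩
    · simp [Real.zero_rpow hp0.ne']
    · simp [← hV, hη]
  obtain ⟨Z, hZm, hZ, hZ1, hZV⟩ := hf.exists_extremal hpq hP ha hV
  set V := slope q f P a
  have hconj : ENNReal.HolderConjugate (ENNReal.ofReal q) (ENNReal.ofReal p) :=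
    hpq.symm.ennrealOfReal
  have h1p : (1 : ℝ≥0∞) ≤ ENNReal.ofReal p := one_le_ofReal_of_holderConjugate hpq.symm
  set n : Fin T → ℝ := fun t => lpNorm (Z t) (ENNReal.ofReal p) P
  have hn0 : ∀ t, 0 ≤ n t := fun t => lpNorm_nonneg
  have hn1 : ∑ t, n t ^ p = 1 := by
    rw [← hZ1]
    exact Finset.sum_congr rfl fun t _ => lpNorm_rpow_eq_integral hp0 (hZ t)
  -- Shrinking by `θ < 1` leaves room in the constraint for the approximation error `δ`.
  obtain ⟨θ, ⟨hθ0, hθ1⟩, hθ⟩ : ∃ θ : ℝ, (0 < θ ∧ θ < 1) ∧ V - η / 2 < θ * V := by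
    have h1 : ∀ᶠ θ in 𝓝[<] (1 : ℝ), V - η / 2 < θ * V := by
      have : Tendsto (fun θ : ℝ => θ * V) (𝓝[<] 1) (𝓝 (1 * V)) :=
        (tendsto_nhdsWithin_of_tendsto_nhds tendsto_id).mul_const V
      rw [one_mul] at this
      exact this.eventually (lt_mem_nhds (by linarith))
    have h2 : ∀ᶠ θ in 𝓝[<] (1 : ℝ), 0 < θ ∧ θ < 1 := Ioo_mem_nhdsLT zero_lt_one
    exact (h2.and h1).exists
  set G := ∑ t, lpNorm (condPartial f P a t) (ENNReal.ofReal q) P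
  obtain ⟨δ, hδ0, hδ1, hδ2⟩ : ∃ δ : ℝ, 0 < δ ∧ ∑ t, (θ * n t + δ) ^ p < 1 ∧ G * δ < η / 2 := by
    have h1 : ∀ᶠ δ in 𝓝[>] (0 : ℝ), ∑ t, (θ * n t + δ) ^ p < 1 := by
      have hc : Tendsto (fun δ : ℝ => ∑ t, (θ * n t + δ) ^ p) (𝓝[>] 0)
          (𝓝 (∑ t, (θ * n t + 0) ^ p)) := by
        refine tendsto_finsetSum _ fun t _ => Tendsto.rpow_const ?_ (Or.inr hp0.le)
        exact tendsto_const_nhds.add (tendsto_nhdsWithin_of_tendsto_nhds tendsto_id)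
      refine hc.eventually (gt_mem_nhds ?_)
      simp only [add_zero, Real.mul_rpow hθ0.le (hn0 _)]
      rw [← Finset.mul_sum, hn1, mul_one]
      exact Real.rpow_lt_one hθ0.le hθ1 hp0
    have h2 : ∀ᶠ δ in 𝓝[>] (0 : ℝ), G * δ < η / 2 := by
      have hc : Tendsto (fun δ : ℝ => G * δ) (𝓝[>] 0) (𝓝 (G * 0)) :=
        (tendsto_nhdsWithin_of_tendsto_nhds tendsto_id).const_mul G
      rw [mul_zero] at hc
      exact hc.eventually (gt_mem_nhds (by linarith))
    obtain ⟨δ, ⟨h3, h4⟩, h5⟩ := ((h1.and h2).and eventually_mem_nhdsWithin).exists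
    exact ⟨δ, h5, h3, h4⟩
  have hθZ : ∀ t, MemLp (fun x => θ * Z t x) (ENNReal.ofReal p) P := fun t => (hZ t).const_mul θ
  choose Y hYm hYK hYM hY hYδ using fun t =>
    exists_lipschitz_approx hp ((hZm t).const_mul θ) (hθZ t) hδ0
  choose K hK using hYK
  choose M hM using hYM
  have hnorm : ∀ t, lpNorm (fun x => θ * Z t x) (ENNReal.ofReal p) P = θ * n t := fun t => by
    have : lpNorm (θ • Z t) (ENNReal.ofReal p) P = θ * lpNorm (Z t) (ENNReal.ofReal p) P := by
      simpa [abs_of_pos hθ0] using lpNorm_const_smul (p := ENNReal.ofReal p) θ (Z t) P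
    exact this
  have hYi : ∀ t, Integrable (fun x => condPartial f P a t x * Y t x) P := fun t =>
    (hf.memLp_condPartial hpq hP ha t).integrable_mul (hY t)
  have hYi' : ∀ t, Integrable (fun x => partialX f t x (a x) * Y t x) P := fun t =>
    (hf.memLp_partialX_control hpq hP ha t).integrable_mul (hY t)
  refine ⟨fun x t => Y t x, fun t => hYm t, ⟨∑ t, K t, ?_⟩, ⟨∑ t, |M t|, fun x => ?_⟩, ?_, ?_⟩
  · refine LipschitzWith.of_dist_le_mul fun x y => ?_
    refine (dist_pi_le_iff (by positivity)).2 fun t => ((hK t).dist_le_mul x y).trans ?_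
    refine mul_le_mul_of_nonneg_right ?_ dist_nonneg
    exact NNReal.coe_le_coe.2 (Finset.single_le_sum (f := K) (fun _ _ => zero_le)
      (Finset.mem_univ t))
  · refine (pi_norm_le_iff_of_nonneg (Finset.sum_nonneg fun _ _ => abs_nonneg _)).2 fun t => ?_
    exact ((hM t x).trans (le_abs_self _)).trans
      (Finset.single_le_sum (f := fun t => |M t|) (fun _ _ => abs_nonneg _) (Finset.mem_univ t))
  · refine le_trans (Finset.sum_le_sum fun t _ => ?_) hδ1.le
    rw [← lpNorm_rpow_eq_integral hp0 (hY t)]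
    refine Real.rpow_le_rpow lpNorm_nonneg ?_ hp0.le
    refine (lpNorm_le_lpNorm_add_lpNorm_sub (hθZ t) h1p).trans ?_
    rw [hnorm]
    exact add_le_add_right (hYδ t) _
  · have hproj : ∀ t, ∫ x, partialX f t x (a x) * Y t x ∂P
        = ∫ x, condPartial f P a t x * Y t x ∂P := fun t => by
      rw [← integral_condExp (pathSigma_le T (t + 1))]
      exact integral_congr_ae (condExp_mul_of_stronglyMeasurable_right (hYm t).stronglyMeasurable
        (hYi' t) (hf.integrable_partialX_control hpq hP ha t))
    rw [integral_finsetSum _ fun t _ => hYi' t]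
    simp only [hproj]
    have hterm : ∀ t, θ * ∫ x, condPartial f P a t x * Z t x ∂P
        - lpNorm (condPartial f P a t) (ENNReal.ofReal q) P * δ
          ≤ ∫ x, condPartial f P a t x * Y t x ∂P := fun t => by
      have hg := hf.memLp_condPartial hpq hP ha t
      have hZi : Integrable (fun x => condPartial f P a t x * Z t x) P := hg.integrable_mul (hZ t)
      have h1 := abs_integral_mul_le_lpNorm hpq hg ((hθZ t).sub (hY t))
      have h2 : ∫ x, condPartial f P a t x * ((fun x => θ * Z t x) - Y t) x ∂P
          = θ * ∫ x, condPartial f P a t x * Z t x ∂P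
            - ∫ x, condPartial f P a t x * Y t x ∂P := by
        rw [← integral_const_mul, ← integral_sub (hZi.const_mul θ) (hYi t)]
        refine integral_congr_ae (Eventually.of_forall fun x => ?_)
        simp only [Pi.sub_apply]
        ring
      rw [h2] at h1
      have h3 := mul_le_mul_of_nonneg_left (hYδ t)
        (lpNorm_nonneg (f := condPartial f P a t) (p := ENNReal.ofReal q) (μ := P))
      linarith [(abs_le.1 h1).2]
    have hs := Finset.sum_le_sum fun t (_ : t ∈ Finset.univ) => hterm t
    rw [Finset.sum_sub_distrib, ← Finset.mul_sum, ← Finset.sum_mul, hZV] at hs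
    linarith

end Extremal

/-! ### The robust value -/

section Robust

variable {T : ℕ} {p q L : ℝ} {P : Measure (Fin T → ℝ)} {f : (Fin T → ℝ) → (Fin T → ℝ) → ℝ}

theorem self_mem_ball (hp : 1 < p) (hP : IsModel T p P) {r : ℝ} (hr : 0 ≤ r) :
    P ∈ ball p P r := by
  have h := map_add_smul_mem_ball hp hP (Z := fun _ => 0) (fun _ => measurable_const)
    (LipschitzWith.const 0) (M := 0) (by simp)
    (by simp [Real.zero_rpow (by linarith : p ≠ 0)]) hr (by simp)
  simpa using h

theorem integral_norm_rpow_le_of_mem_ball (hp : 1 < p) (hP : IsModel T p P) {r : ℝ} (hr : 0 ≤ r)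
    {Q : Measure (Fin T → ℝ)} (hQ : Q ∈ ball p P r) :
    ∫ y, ‖y‖ ^ p ∂Q ≤ 2 ^ p * (∫ x, ‖x‖ ^ p ∂P + (r + 1) ^ p) := by
  have hp0 : 0 < p := by linarith
  obtain ⟨π, hc, -, hint, hcost⟩ :=
    exists_coupling_of_adaptedW_le hp0 hr (lt_add_one r) hQ.2
  obtain ⟨hi, hir⟩ := integrable_norm_sub_rpow hp0 hint hcost
  have hX : Integrable (fun z : (Fin T → ℝ) × (Fin T → ℝ) => ‖z.1‖ ^ p) π :=
    hc.measurePreserving_fst.integrable_comp_of_integrable (hP.integrable_norm_rpow hp0)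
  have hY : Integrable (fun z : (Fin T → ℝ) × (Fin T → ℝ) => ‖z.2‖ ^ p) π :=
    hc.measurePreserving_snd.integrable_comp_of_integrable (hQ.1.integrable_norm_rpow hp0)
  have e1 : ∫ x, ‖x‖ ^ p ∂P = ∫ z, ‖z.1‖ ^ p ∂π := by
    have h := integral_map (μ := π) (φ := Prod.fst) measurable_fst.aemeasurable
      (f := fun x => ‖x‖ ^ p) (measurable_norm.pow_const p).aestronglyMeasurable
    rwa [hc.1] at h
  have e2 : ∫ x, ‖x‖ ^ p ∂Q = ∫ z, ‖z.2‖ ^ p ∂π := by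
    have h := integral_map (μ := π) (φ := Prod.snd) measurable_snd.aemeasurable
      (f := fun x => ‖x‖ ^ p) (measurable_norm.pow_const p).aestronglyMeasurable
    rwa [hc.2] at h
  rw [e1, e2]
  calc ∫ z, ‖z.2‖ ^ p ∂π ≤ ∫ z, 2 ^ p * (‖z.1‖ ^ p + ‖z.2 - z.1‖ ^ p) ∂π := by
        refine integral_mono hY ((hX.add hi).const_mul _) fun z => ?_
        refine le_trans (Real.rpow_le_rpow (norm_nonneg _) ?_ hp0.le)
          (add_rpow_le hp0.le (norm_nonneg _) (norm_nonneg _))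
        simpa using norm_add_le z.1 (z.2 - z.1)
    _ = 2 ^ p * (∫ z, ‖z.1‖ ^ p ∂π + ∫ z, ‖z.2 - z.1‖ ^ p ∂π) := by
        rw [integral_const_mul, integral_add hX hi]
    _ ≤ _ := by gcongr

theorem IsAdmissibleCost.bddAbove_value (hf : IsAdmissibleCost p L P f) (hp : 1 < p) (hL : 0 ≤ L)
    (hP : IsModel T p P) {r : ℝ} (hr : 0 ≤ r) : BddAbove (value L f '' ball p P r) := by
  obtain ⟨C, hC, hb⟩ := hf.exists_abs_cost_le hp
  refine ⟨C * (1 + 2 ^ p * (∫ x, ‖x‖ ^ p ∂P + (r + 1) ^ p)), ?_⟩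
  rintro _ ⟨Q, hQ, rfl⟩
  have h0 := const_zero_mem_controls (T := T) hL
  refine ((hf.value_le_cost hp hQ.1 h0).trans (abs_le.1 (hb Q hQ.1 _ h0)).2).trans ?_
  have := integral_norm_rpow_le_of_mem_ball hp hP hr hQ
  gcongr

/-- The first-order expansion of the robust value in the radius of the ball. -/
theorem IsAdmissibleCost.sSup_value_isLittleO (hf : IsAdmissibleCost p L P f)
    (hpq : p.HolderConjugate q) (hL : 0 ≤ L) (hP : IsModel T p P)
    {a : (Fin T → ℝ) → (Fin T → ℝ)} (ha : a ∈ controls T L) (hopt : value L f P = cost f P a) :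
    (fun r : ℝ => sSup (value L f '' ball p P r) - (value L f P + r * slope q f P a))
      =o[𝓝[>] (0 : ℝ)] fun r : ℝ => r := by
  have hp := hpq.lt
  refine isLittleO_iff.2 fun η hη => ?_
  obtain ⟨K, hK, hup⟩ := hf.value_le_of_mem_ball hpq hL hP ha hopt (half_pos hη)
  obtain ⟨Z, hZ, ⟨κ, hκ⟩, ⟨M, hM⟩, hZ1, hZV⟩ := hf.exists_direction hpq hP ha hη
  have hlow := hf.eventually_le_value_map hp hL hP ha hopt hZ hM hZV
  have hpos : ∀ᶠ r in 𝓝[>] (0 : ℝ), 0 < r := eventually_mem_nhdsWithin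
  have hsmall : ∀ᶠ r : ℝ in 𝓝[>] 0, r * (κ : ℝ) < 1 := by
    have : Tendsto (fun r : ℝ => r * κ) (𝓝[>] (0 : ℝ)) (𝓝 (0 * (κ : ℝ))) :=
      (tendsto_nhdsWithin_of_tendsto_nhds tendsto_id).mul_const _
    rw [zero_mul] at this
    exact this.eventually (gt_mem_nhds one_pos)
  have hrem : ∀ᶠ r in 𝓝[>] (0 : ℝ), K * r ^ (p - 1) < η / 2 := by
    have : Tendsto (fun r : ℝ => K * r ^ (p - 1)) (𝓝[>] 0) (𝓝 (K * 0 ^ (p - 1))) :=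
      ((tendsto_nhdsWithin_of_tendsto_nhds tendsto_id).rpow_const
        (Or.inr (by linarith))).const_mul _
    rw [Real.zero_rpow (by linarith), mul_zero] at this
    exact this.eventually (gt_mem_nhds (half_pos hη))
  filter_upwards [hlow, hpos, hsmall, hrem] with r hlow hr hsmall hrem
  have hmem := map_add_smul_mem_ball hp hP hZ hκ hM hZ1 hr.le hsmall
  have h1 := le_csSup (hf.bddAbove_value hp hL hP hr.le) ⟨_, hmem, rfl⟩
  have h2 : sSup (value L f '' ball p P r)
      ≤ value L f P + r * slope q f P a + (η / 2 * r + K * r ^ p) := by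
    refine csSup_le ⟨_, _, hmem, rfl⟩ ?_
    rintro _ ⟨Q, hQ, rfl⟩
    exact hup r hr.le Q hQ
  have h3 : r ^ p = r ^ (p - 1) * r := by
    rw [← Real.rpow_add_one hr.ne', sub_add_cancel]
  have h4 : K * r ^ p ≤ η / 2 * r := by
    rw [h3, ← mul_assoc]
    exact mul_le_mul_of_nonneg_right hrem.le hr.le
  rw [Real.norm_eq_abs, Real.norm_of_nonneg hr.le, abs_le]
  constructor
  · rw [mul_sub] at hlow
    linarith
  · linarith

end Robust

end AdaptedOpt

end

theorem theorem2 (T : ℕ) (p q L : ℝ) (hp : 1 < p) (hq : q = p / (p - 1)) (hL : 0 ≤ L)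
    (P : Measure (Fin T → ℝ)) (hP : AdaptedOpt.IsModel T p P)
    (f : (Fin T → ℝ) → (Fin T → ℝ) → ℝ) (hf : AdaptedOpt.IsAdmissibleCost p L P f) :
    (∀ Q, AdaptedOpt.IsModel T p Q → ∀ a ∈ AdaptedOpt.controls T L,
      Integrable (fun x => f x (a x)) Q) ∧
    (∀ Q, AdaptedOpt.IsModel T p Q →
      BddBelow (AdaptedOpt.cost f Q '' AdaptedOpt.controls T L)) ∧
    (∀ r : ℝ, 0 ≤ r →
      (AdaptedOpt.ball p P r).Nonempty ∧
      BddAbove (AdaptedOpt.value L f '' AdaptedOpt.ball p P r)) ∧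
    ∃ a ∈ AdaptedOpt.controls T L,
      AdaptedOpt.value L f P = AdaptedOpt.cost f P a ∧
      (∀ b ∈ AdaptedOpt.controls T L,
        AdaptedOpt.value L f P = AdaptedOpt.cost f P b → b =ᵐ[P] a) ∧
      (∀ t : Fin T, Integrable (fun x => AdaptedOpt.partialX f t x (a x)) P ∧
        Integrable (fun x => |AdaptedOpt.condPartial f P a t x| ^ q) P) ∧
      (fun r : ℝ => sSup (AdaptedOpt.value L f '' AdaptedOpt.ball p P r)
          - (AdaptedOpt.value L f P
            + r * (∑ t : Fin T, ∫ x, |AdaptedOpt.condPartial f P a t x| ^ q ∂P) ^ (1 / q)))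
        =o[𝓝[>] (0 : ℝ)] fun r : ℝ => r := by
  have hpq : p.HolderConjugate q := (Real.holderConjugate_iff_eq_conjExponent hp).2 hq
  obtain ⟨a, ha, hopt⟩ := hf.exists_optimal hp hL hP
  refine ⟨fun Q hQ a ha => hf.integrable_cost hp hQ ha, fun Q hQ => hf.bddBelow_cost hp hQ,
    fun r hr => ⟨⟨P, AdaptedOpt.self_mem_ball hp hP hr⟩, hf.bddAbove_value hp hL hP hr⟩,
    a, ha, hopt, fun b hb hb' => hf.optimal_unique hp hP ha hopt hb hb', fun t => ?_, ?_⟩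
  · exact ⟨hf.integrable_partialX_control hpq hP ha t,
      AdaptedOpt.integrable_abs_rpow_of_memLp hpq.symm.pos (hf.memLp_condPartial hpq hP ha t)⟩
  · exact hf.sSup_value_isLittleO hpq hL hP ha hopt
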